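/- **Setting.** Let $X\subseteq\mathbb{R}^d$ be closed and let $\rho$ be a Borel probability measure on $X\times\mathbb{R}$ with $\int y^2\,d\rho<\infty$, marginal $\rho_X$ on $X$ and conditional laws $\rho(\cdot\mid x)$. Write $\|\cdot\|_\rho$ for the norm of $\mathcal L^2_\rho=L^2(X,\rho_X)$, $\mathcal E(f)=\int (f(x)-y)^2\,d\rho(x,y)$, and $f_\rho(x)=\int y\,d\rho(y\mid x)$. Let $\mu$ be a probability measure on a measurable space $V$, let $\phi:V\times X\to\mathbb{R}$, $\phi_v(x)=\phi(v,x)$, be measurable and square-integrable with respect to $\mu\otimes\rho_X$, with $\phi(\cdot,x)\in L^2(\mu)$ for all $x\in X$, and put $$K(x,x')=\int_V\phi_v(x)\phi_v(x')\,d\mu(v),\qquad x,x'\in X .$$ Let $L_K:\mathcal L^2_\rho\to\mathcal L^2_\rho$ be the positive operator $(L_Kf)(x)=\int_X K(x,u)f(u)\,d\rho_X(u)$. Assume: 1. (boundedness) for a constant $\kappa\ge1$, $K(x,x)\le\kappa^2$ and $\phi_v(x)\phi_v(x')\le\kappa^2$ almost surely, where $v\sim\mu$ and $x,x'\sim\rho_X$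 are independent; 2. (regularity) $\|L_K^{-\zeta}f_\rho\|_\rho\le R$ for some $\zeta>0$, $R>0$, i.e. $f_\rho=L_K^{\zeta}g$ for some $g$ with $\|g\|_\rho\le R$; 3. (capacity) $\operatorname{tr}\big(L_K(L_K+\lambda I)^{-1}\big)\le c_\gamma\lambda^{-\gamma}$ for all $\lambda>0$, for some $\gamma\in[0,1]$, $c_\gamma>0$. For $T\in\mathbb{N}$, $T\ge1$, let $z_t=(x_t,y_t)\sim\rho$ and $v_t\sim\mu$, $t=1,\dots,T$, be independent, and, for $\lambda\ge 0$ and step sizes $\eta_t>0$, define $f_1=0$ and $$f_{t+1}=(1-\eta_t\lambda)f_t-\eta_t\,(f_t(x_t)-y_t)\,\phi_{v_t}(x_t)\,\phi_{v_t},\qquad t=1,\dots,T .$$ **Theorem.** Let $\zeta\le1$, $\gamma\ne1$, $\frac{\gamma}{\gamma+1}<\theta<1$, $0<\epsilon\le1-\theta$ and $\eta_1>0$. Then there is a constant $C>0$, depending only on $\zeta,R,\gamma,c_\gamma,\kappa,\theta,\epsilon,\eta_1$ and on upper bounds for $\|f_\rho\|_\rho$ and $\mathcal E(f_\rho)$,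 such that for every $T\ge1$ with $$\eta_1\le\frac{1}{4\kappa^2\,(2^{2\theta}c_\gamma+\kappa^2)\,c_{\theta,\gamma}},\qquad c_{\theta,\gamma}=\max_{1\le t\le T}\Big\{t^{\gamma-\theta(\gamma+1)+(2\theta-1)_+}\ln(2t)\Big\},$$ where $(a)_+=\max(a,0)$, the iterates with $\lambda=T^{\theta-1+\epsilon}$ and $\eta_t=\eta_1t^{-\theta}$ satisfy $$\mathbb{E}_{\{z_j,v_j\}_{j=1}^T}\big[\|f_{T+1}-f_\rho\|_\rho^2\big]\le C\Big(T^{2\zeta(\theta-1+\epsilon)}+T^{\gamma-\theta(\gamma+1)}\ln T\Big).$$ -/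

import Mathlib

open MeasureTheory ProbabilityTheory
open scoped ENNReal NNReal InnerProductSpace

noncomputable section

namespace DoublyStochastic

/-! ### Integral operators on `L²` -/

section IntegralOperator

variable {α : Type*} [MeasurableSpace α] {ν : Measure α}

theorem sq_integral_mul_le {a b : α → ℝ} (ha : MemLp a 2 ν) (hb : MemLp b 2 ν) :
    (∫ x, a x * b x ∂ν) ^ 2 ≤ (∫ x, a x ^ 2 ∂ν) * ∫ x, b x ^ 2 ∂ν := by
  have key : ∀ {c d : α → ℝ} (hc : MemLp c 2 ν) (hd : MemLp d 2 ν),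
      ⟪hc.toLp c, hd.toLp d⟫_ℝ = ∫ x, c x * d x ∂ν := by
    intro c d hc hd
    rw [L2.inner_def]
    refine integral_congr_ae ?_
    filter_upwards [hc.coeFn_toLp, hd.coeFn_toLp] with x h1 h2
    rw [h1, h2]
    simp [mul_comm]
  have h := real_inner_mul_inner_self_le (ha.toLp a) (hb.toLp b)
  rw [key ha hb, key ha ha, key hb hb] at h
  simpa [sq] using h

variable [SFinite ν] {K : α → α → ℝ}

theorem memLp_section (hK : MemLp (Function.uncurry K) 2 (ν.prod ν)) :
    ∀ᵐ x ∂ν, MemLp (K x) 2 ν := by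
  have h2 := hK.integrable_sq.prod_right_ae
  filter_upwards [hK.1.prodMk_left, h2] with x h3 h4
  exact (memLp_two_iff_integrable_sq h3).2 h4

theorem sq_integral_kernel_le (hK : MemLp (Function.uncurry K) 2 (ν.prod ν)) (f : Lp ℝ 2 ν) :
    ∀ᵐ x ∂ν, (∫ u, K x u * f u ∂ν) ^ 2 ≤ (∫ u, K x u ^ 2 ∂ν) * ‖f‖ ^ 2 := by
  filter_upwards [memLp_section hK] with x hx
  have h := sq_integral_mul_le hx (Lp.memLp f)
  have hf : ∫ u, f u ^ 2 ∂ν = ‖f‖ ^ 2 := by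
    rw [← real_inner_self_eq_norm_sq, L2.inner_def]
    refine integral_congr_ae (Filter.Eventually.of_forall fun x => ?_)
    simp [sq]
  rwa [hf] at h

theorem memLp_integral_kernel (hK : MemLp (Function.uncurry K) 2 (ν.prod ν)) (f : Lp ℝ 2 ν) :
    MemLp (fun x => ∫ u, K x u * f u ∂ν) 2 ν := by
  have hm : AEStronglyMeasurable (fun x => ∫ u, K x u * f u ∂ν) ν := by
    refine AEStronglyMeasurable.integral_prod_right' (f := fun p : α × α => K p.1 p.2 * f p.2) ?_
    exact hK.1.mul (Lp.aestronglyMeasurable f).comp_snd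
  refine (memLp_two_iff_integrable_sq hm).2 ?_
  refine Integrable.mono' (hK.integrable_sq.integral_prod_left.mul_const (‖f‖ ^ 2)) (hm.pow 2) ?_
  filter_upwards [sq_integral_kernel_le hK f] with x hx
  rw [Real.norm_of_nonneg (sq_nonneg _)]
  exact hx

/-- The integral operator `(L f)(x) = ∫ K(x,u) f(u) dν(u)` on `L²(ν)` with a square-integrable
kernel `K`. -/
def integralOperator (hK : MemLp (Function.uncurry K) 2 (ν.prod ν)) :
    Lp ℝ 2 ν →L[ℝ] Lp ℝ 2 ν :=
  LinearMap.mkContinuous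
    { toFun := fun f => (memLp_integral_kernel hK f).toLp _
      map_add' := by
        intro f g
        rw [← MemLp.toLp_add, MemLp.toLp_eq_toLp_iff]
        filter_upwards [memLp_section hK] with x hx
        have hf : Integrable (fun u => K x u * f u) ν := hx.integrable_mul (Lp.memLp f)
        have hg : Integrable (fun u => K x u * g u) ν := hx.integrable_mul (Lp.memLp g)
        rw [Pi.add_apply, ← integral_add hf hg]
        refine integral_congr_ae ?_
        filter_upwards [Lp.coeFn_add f g] with u hu
        rw [hu, Pi.add_apply, mul_add]
      map_smul' := by
        intro c f
        rw [RingHom.id_apply, ← MemLp.toLp_const_smul, MemLp.toLp_eq_toLp_iff]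
        refine Filter.Eventually.of_forall fun x => ?_
        rw [Pi.smul_apply, smul_eq_mul, ← integral_const_mul]
        refine integral_congr_ae ?_
        filter_upwards [Lp.coeFn_smul c f] with u hu
        rw [hu, Pi.smul_apply, smul_eq_mul]
        ring }
    (Real.sqrt (∫ x, ∫ u, K x u ^ 2 ∂ν ∂ν))
    (by
      intro f
      have h0 : 0 ≤ ∫ x, ∫ u, K x u ^ 2 ∂ν ∂ν :=
        integral_nonneg fun x => integral_nonneg fun u => sq_nonneg _
      refine le_of_sq_le_sq ?_ (by positivity)
      rw [mul_pow, Real.sq_sqrt h0, ← integral_mul_const, ← real_inner_self_eq_norm_sq,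
        L2.inner_def]
      refine integral_mono_ae (L2.integrable_inner _ _)
        (hK.integrable_sq.integral_prod_left.mul_const (‖f‖ ^ 2)) ?_
      filter_upwards [sq_integral_kernel_le hK f, (memLp_integral_kernel hK f).coeFn_toLp]
        with x hx h1
      simp only [LinearMap.coe_mk, AddHom.coe_mk]
      rw [h1]
      simpa [sq] using hx)

end IntegralOperator

/-! ### Powers and traces of operators -/

section Operators

variable {H : Type*} [NormedAddCommGroup H] [InnerProductSpace ℝ H] [CompleteSpace H]

/-- The power `L^ζ` of a compact positive self-adjoint operator `L`, through the spectral theorem: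
`L^ζ f = ∑_σ σ^ζ P_σ f`, with `P_σ` the orthogonal projection onto the eigenspace
`{u | L u = σ u}`; only the countably many eigenvalues `σ` of `L` contribute. -/
def spectralPower (L : H →L[ℝ] H) (ζ : ℝ) (f : H) : H :=
  ∑' σ : ℝ, σ ^ ζ • (L - σ • ContinuousLinearMap.id ℝ H).ker.starProjection f

/-- The trace `∑_i ⟨e_i, A e_i⟩ ∈ [0,∞]` of a positive operator `A`, in a Hilbert basis `(e_i)`
(for positive `A` its value does not depend on the basis). -/
def opTrace (A : H →L[ℝ] H) : ℝ≥0∞ :=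
  let b := (exists_hilbertBasis ℝ H).choose_spec.choose
  ∑' i, ENNReal.ofReal ⟪b i, A (b i)⟫_ℝ

/-- The effective dimension `tr (L (L + λ I)⁻¹)` of a positive operator `L`, for `λ > 0`. -/
def effectiveDimension (L : H →L[ℝ] H) (lam : ℝ) : ℝ≥0∞ :=
  opTrace (L * Ring.inverse (L + lam • ContinuousLinearMap.id ℝ H))

end Operators

/-! ### The learning problem -/

/-- Least squares regression with random features: `ρ` is the law of a pair `(x, y)` with
`∫ y² dρ < ∞`, `μ` is the law of a feature parameter `v`, `φ` is a square-integrable feature map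
and `K` is the kernel `K(x,x') = ∫ φ(v,x) φ(v,x') dμ(v)` (so that `K` is automatically symmetric
and positive semidefinite). -/
structure Problem (α V : Type*) [MeasurableSpace α] [MeasurableSpace V] where
  ρ : Measure (α × ℝ)
  ρ_prob : IsProbabilityMeasure ρ
  ρ_sq : Integrable (fun z : α × ℝ => z.2 ^ 2) ρ
  μ : Measure V
  μ_prob : IsProbabilityMeasure μ
  φ : V → α → ℝ
  φ_measurable : Measurable (Function.uncurry φ)
  φ_memLp : MemLp (Function.uncurry φ) 2 (μ.prod ρ.fst)
  φ_memLp_left : ∀ x, MemLp (fun v => φ v x) 2 μ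
  K : α → α → ℝ
  K_eq : ∀ x x', K x x' = ∫ v, φ v x * φ v x' ∂μ

namespace Problem

attribute [instance] Problem.ρ_prob Problem.μ_prob

variable {α V : Type*} [MeasurableSpace α] [MeasurableSpace V] (P : Problem α V)

/-- The marginal law of the input `x`. -/
def ρX : Measure α := P.ρ.fst

instance : IsProbabilityMeasure P.ρX := inferInstanceAs (IsProbabilityMeasure P.ρ.fst)

/-- The regression function `f_ρ(x) = ∫ y dρ(y|x)`. -/
def regression (x : α) : ℝ := ∫ y, y ∂(P.ρ.condKernel x)

/-- The expected risk `𝓔(f) = ∫ (f(x) - y)² dρ(x,y)`. -/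
def risk (f : α → ℝ) : ℝ≥0∞ := ∫⁻ z, ENNReal.ofReal ((f z.1 - z.2) ^ 2) ∂P.ρ

/-- The norm of `L²(ρ_X)`. -/
def rhoNorm (f : α → ℝ) : ℝ≥0∞ := eLpNorm f 2 P.ρX

theorem memLp_K : MemLp (Function.uncurry P.K) 2 (P.ρX.prod P.ρX) := by
  have hm : StronglyMeasurable (Function.uncurry P.K) := by
    have h : StronglyMeasurable (fun p : (α × α) × V => P.φ p.2 p.1.1 * P.φ p.2 p.1.2) := by
      refine Measurable.stronglyMeasurable (Measurable.mul ?_ ?_)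
      · exact P.φ_measurable.comp (measurable_snd.prodMk (measurable_fst.comp measurable_fst))
      · exact P.φ_measurable.comp (measurable_snd.prodMk (measurable_snd.comp measurable_fst))
    have h' := h.integral_prod_right' (ν := P.μ)
    convert h' using 1
    ext p
    exact P.K_eq p.1 p.2
  have hd : Integrable (fun x => ∫ v, P.φ v x ^ 2 ∂P.μ) P.ρX :=
    (P.φ_memLp.integrable_sq).integral_prod_right
  refine (memLp_two_iff_integrable_sq hm.aestronglyMeasurable).2 ?_
  refine Integrable.mono' (hd.mul_prod hd) (hm.aestronglyMeasurable.pow 2)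
    (Filter.Eventually.of_forall fun p => ?_)
  rw [Real.norm_of_nonneg (sq_nonneg _)]
  change P.K p.1 p.2 ^ 2 ≤ _
  rw [P.K_eq]
  exact sq_integral_mul_le (P.φ_memLp_left p.1) (P.φ_memLp_left p.2)

/-- The operator `L_K : L²(ρ_X) → L²(ρ_X)`, `L_K f = ∫ f(x) K_x dρ_X(x)`. -/
def LK : Lp ℝ 2 P.ρX →L[ℝ] Lp ℝ 2 P.ρX := integralOperator P.memLp_K

/-- Boundedness: `K(x,x) ≤ κ²` and `φ_v(x) φ_v(x') ≤ κ²` almost surely, with `v` drawn from `μ`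
and `x`, `x'` drawn from `ρ_X`. -/
def BoundedBy (κ : ℝ) : Prop :=
  (∀ᵐ x ∂P.ρX, P.K x x ≤ κ ^ 2) ∧
    ∀ᵐ p ∂(P.μ.prod (P.ρX.prod P.ρX)), P.φ p.1 p.2.1 * P.φ p.1 p.2.2 ≤ κ ^ 2

/-- Regularity: `‖L_K^{-ζ} f_ρ‖_ρ ≤ R`, that is, `f_ρ = L_K^ζ g` for some `‖g‖_ρ ≤ R`. -/
def RegularityBound (ζ R : ℝ) : Prop :=
  ∃ g : Lp ℝ 2 P.ρX, ‖g‖ ≤ R ∧ ⇑(spectralPower P.LK ζ g : Lp ℝ 2 P.ρX) =ᵐ[P.ρX] P.regression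

/-- Capacity: `tr (L_K (L_K + λ I)⁻¹) ≤ c λ^{-γ}` for all `λ > 0`. -/
def CapacityBound (γ c : ℝ) : Prop :=
  ∀ lam : ℝ, 0 < lam → effectiveDimension P.LK lam ≤ ENNReal.ofReal (c * lam ^ (-γ))

/-- The doubly stochastic iterates: `iterate lam η t w` is `f_{t+1}`, computed from the first `t`
samples `w = ((x_1,y_1),v_1), …, ((x_t,y_t),v_t)` with regularization parameter `lam` and step sizes
`η 1, …, η t`, by `f_1 = 0` and
`f_{t+1} = (1 - η_t λ) f_t - η_t (f_t(x_t) - y_t) φ_{v_t}(x_t) φ_{v_t}`. -/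
def iterate (lam : ℝ) (η : ℕ → ℝ) : (t : ℕ) → (Fin t → (α × ℝ) × V) → α → ℝ
  | 0, _ => fun _ => 0
  | t + 1, w => fun u =>
      let f := iterate lam η t (Fin.init w)
      let x := (w (Fin.last t)).1.1
      let y := (w (Fin.last t)).1.2
      let v := (w (Fin.last t)).2
      (1 - η (t + 1) * lam) * f u - η (t + 1) * (f x - y) * P.φ v x * P.φ v u

/-- `𝔼 ‖f_{T+1} - f_ρ‖_ρ²`, the expectation being over independent `z_1, …, z_T` with law `ρ` and
`v_1, …, v_T` with law `μ`. -/
def expectedError (lam : ℝ) (η : ℕ → ℝ) (T : ℕ) : ℝ≥0∞ :=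
  ∫⁻ w, P.rhoNorm (fun u => P.iterate lam η T w u - P.regression u) ^ 2
    ∂(Measure.pi fun _ : Fin T => P.ρ.prod P.μ)

end Problem

/-- `c_{θ,γ} = max_{1 ≤ t ≤ T} t^{γ - θ(γ+1) + (2θ-1)₊} ln (2t)`. -/
def cThetaGamma (θ γ : ℝ) (T : ℕ) (hT : 1 ≤ T) : ℝ :=
  (Finset.Icc 1 T).sup' (Finset.nonempty_Icc.mpr hT) fun t : ℕ =>
    (t : ℝ) ^ (γ - θ * (γ + 1) + max (2 * θ - 1) 0) * Real.log (2 * t)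

end DoublyStochastic

end

/-! Write `L` for `L_K`. The iterates are compared with `h = (L + λ)⁻¹ L f_ρ`, the fixed point of
the averaged iteration. The approximation error `h - f_ρ = -λ (L + λ)⁻¹ f_ρ` has norm at most `λ^ζ
R`, since `λ σ^ζ / (σ + λ) ≤ λ^ζ` for `ζ ≤ 1` (`norm_resolvent_spectralPower_le`).

Given the past, the stochastic gradient at `f_t` has mean `L (f_t - f_ρ)`, so `f_{t+1} - h` is `(I -
η_t (L + λ)) (f_t - h)` plus centred noise. Carrying squared norms through the remaining steps
(`errorAlong_le_sum`) gives the norm squared of the full product of steps applied to `h`, plus a sum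
over `s` of `κ² η_s² 𝔼‖A_s φ_v‖² 𝔼 𝓔(f_s)`, with `A_s` the product of the steps after `s`. The noise
splits into these two expectations because `|φ_v(x)| ≤ κ` almost surely.

The capacity condition controls `𝔼‖A_s φ_v‖²`. As `L = 𝔼 φ_v ⊗ φ_v`, this is `tr (A_s L A_s)`. For
`0 ≤ a_i σ ≤ 1` and `S = 2 ∑ a_i` one has `∏ (1 - a_i σ)² (1 + S σ) ≤ 1`; its operator form
`inner_stepProd_le` bounds `A_s L A_s` by `S⁻¹ L (L + S⁻¹)⁻¹`, whose trace is at most `c S^(γ-1)`.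
Regularization contributes a further factor `∏ (1 - a_i λ)²`.

The risk of `f_s` is at most `3/2` times its squared distance to `h` plus a constant. The bound on
`η₁` makes the weights sum to at most `1/2`, and `3/2 · 1/2 < 1`, so the errors stay bounded
uniformly in time. The last error is then of the order of the sum of the weights at time `T`, up to
the forgotten initial value. Since `λ T^(1-θ) = T^ε`, the early half of the samples carries a factor
`exp(-η₁ T^ε)`, which beats every power of `T`; the late half gives `T^(γ-θ(γ+1)) log T`. -/

noncomputable section

namespace DoublyStochastic

/-! ### Positive operators: gradient steps are contractions. -/

section PositiveOperators

variable {H : Type*} [NormedAddCommGroup H] [InnerProductSpace ℝ H]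

/-- `L` is symmetric with numerical range in `[0, k]`. -/
structure BoundedPositive (L : H →L[ℝ] H) (k : ℝ) : Prop where
  symm : ∀ x y, ⟪L x, y⟫_ℝ = ⟪x, L y⟫_ℝ
  nonneg : ∀ x, 0 ≤ ⟪L x, x⟫_ℝ
  le : ∀ x, ⟪L x, x⟫_ℝ ≤ k * ‖x‖ ^ 2

namespace BoundedPositive

variable {L : H →L[ℝ] H} {k : ℝ}

/-- This is `a L² ≤ L`, obtained without a square root of `L`: positivity is tested at `x - a L x`,
and the cubic term is absorbed by the upper bound on the form at `L x`. -/
theorem comp_sub_nonneg (hL : BoundedPositive L k) {a : ℝ} (ha : 0 ≤ a) (hak : a * k ≤ 1) (x : H) :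
    0 ≤ ⟪L x, x⟫_ℝ - a * ‖L x‖ ^ 2 := by
  have h1 := hL.nonneg (x - a • L x)
  have h2 := hL.le (L x)
  have h3 : a ^ 2 * ⟪L (L x), L x⟫_ℝ ≤ a * ‖L x‖ ^ 2 := by
    have := mul_le_mul_of_nonneg_left h2 (sq_nonneg a)
    nlinarith [mul_nonneg ha (sq_nonneg ‖L x‖)]
  have h4 : ⟪L (x - a • L x), x - a • L x⟫_ℝ
      = ⟪L x, x⟫_ℝ - 2 * a * ‖L x‖ ^ 2 + a ^ 2 * ⟪L (L x), L x⟫_ℝ := by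
    simp only [map_sub, map_smul, inner_sub_left, inner_sub_right, inner_smul_left,
      inner_smul_right, hL.symm (L x) x, real_inner_self_eq_norm_sq, RCLike.conj_to_real]
    ring
  linarith

theorem norm_sub_smul_le (hL : BoundedPositive L k) {a : ℝ} (ha : 0 ≤ a) (hak : a * k ≤ 1)
    (x : H) : ‖x - a • L x‖ ≤ ‖x‖ := by
  have h1 := hL.comp_sub_nonneg ha hak x
  have h2 := hL.nonneg x
  refine le_of_sq_le_sq ?_ (norm_nonneg x)
  rw [norm_sub_sq_real, inner_smul_right, norm_smul, mul_pow, Real.norm_eq_abs, sq_abs,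
    real_inner_comm]
  nlinarith [mul_nonneg ha h1, mul_nonneg ha h2]

/-- Factor `1 - a (L + l) = (1 - a l) (1 - a' L)` with `a' = a / (1 - a l)`. The condition `a (k +
l) < 1` yields `a' k ≤ 1`, so the second factor is a contraction. -/
theorem norm_sub_smul_add_le (hL : BoundedPositive L k) {a l : ℝ} (ha : 0 ≤ a)
    (hal : a * (k + l) < 1) (hk : 0 ≤ k) (x : H) :
    ‖x - a • (L x + l • x)‖ ≤ (1 - a * l) * ‖x‖ := by
  have hak : 0 ≤ a * k := mul_nonneg ha hk
  have h1 : 0 < 1 - a * l := by nlinarith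
  have h2 : x - a • (L x + l • x) = (1 - a * l) • (x - (a / (1 - a * l)) • L x) := by
    rw [smul_sub, smul_smul, mul_div_cancel₀ _ h1.ne', smul_add, smul_smul, sub_smul, one_smul]
    abel
  rw [h2, norm_smul, Real.norm_of_nonneg h1.le]
  refine mul_le_mul_of_nonneg_left (hL.norm_sub_smul_le (by positivity) ?_ x) h1.le
  rw [div_mul_eq_mul_div, div_le_one h1]
  nlinarith

end BoundedPositive

end PositiveOperators

/-! ### Products of gradient steps, resolvents and spectral powers. -/

section PositiveOperators

variable {H : Type*} [NormedAddCommGroup H] [InnerProductSpace ℝ H]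

namespace BoundedPositive

variable {L : H →L[ℝ] H} {k : ℝ}

/-- The quadratic form of `(L + s L²) (L + l)`. -/
def form (L : H →L[ℝ] H) (l s : ℝ) (v : H) : ℝ :=
  ⟪L v + s • L (L v), L v + l • v⟫_ℝ

theorem form_smul (l s r : ℝ) (v : H) : form L l s (r • v) = r ^ 2 * form L l s v := by
  simp only [form, map_smul, inner_add_left, inner_add_right, inner_smul_left, inner_smul_right,
    RCLike.conj_to_real]
  ring

theorem form_mono (hL : BoundedPositive L k) {l s t : ℝ} (hl : 0 ≤ l) (hst : s ≤ t) (v : H) :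
    form L l s v ≤ form L l t v := by
  have h1 : form L l t v - form L l s v = (t - s) * (⟪L (L v), L v⟫_ℝ + l * ‖L v‖ ^ 2) := by
    simp only [form, inner_add_left, inner_add_right, inner_smul_left, inner_smul_right,
      RCLike.conj_to_real, hL.symm (L v) v, real_inner_self_eq_norm_sq]
    ring
  have h2 := hL.nonneg (L v)
  have h3 : 0 ≤ (t - s) * (⟪L (L v), L v⟫_ℝ + l * ‖L v‖ ^ 2) :=
    mul_nonneg (by linarith) (by positivity)
  linarith

/-- The operator version of `(1 - a σ)² (1 + (s + 2 a) σ) ≤ 1 + s σ` for `0 ≤ a σ ≤ 1`, multiplied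
by `σ (σ + l)`. The difference of the two sides is `a (s + a) σ² + a (s + 2 a) σ² (1 - a σ)`, which
is the decomposition used below. -/
theorem form_sub_smul_le (hL : BoundedPositive L k) {l s a : ℝ} (hl : 0 ≤ l) (hs : 0 ≤ s)
    (ha : 0 ≤ a) (hak : a * k ≤ 1) (v : H) :
    form L l (s + 2 * a) (v - a • L v) ≤ form L l s v := by
  have h1 : form L l s v - form L l (s + 2 * a) (v - a • L v) =
      a * (s + a) * (‖L (L v)‖ ^ 2 + l * ⟪L (L v), L v⟫_ℝ) +
      a * (s + 2 * a) * ((‖L (L v)‖ ^ 2 - a * ⟪L (L (L v)), L (L v)⟫_ℝ) +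
        l * (⟪L (L v), L v⟫_ℝ - a * ‖L (L v)‖ ^ 2)) := by
    simp only [form, map_sub, map_add, map_smul, inner_add_left, inner_add_right, inner_smul_left,
      inner_smul_right, inner_sub_left, inner_sub_right, smul_sub, smul_smul,
      RCLike.conj_to_real, ← hL.symm, ← real_inner_self_eq_norm_sq]
    ring
  have h2 := hL.nonneg (L v)
  have h3 := hL.comp_sub_nonneg ha hak (L v)
  have h4 : 0 ≤ ‖L (L v)‖ ^ 2 - a * ⟪L (L (L v)), L (L v)⟫_ℝ := by
    have := mul_le_mul_of_nonneg_left (hL.le (L (L v))) ha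
    nlinarith [sq_nonneg ‖L (L v)‖]
  have h5 : 0 ≤ a * (s + a) * (‖L (L v)‖ ^ 2 + l * ⟪L (L v), L v⟫_ℝ) := by positivity
  have h6 : 0 ≤ a * (s + 2 * a) * ((‖L (L v)‖ ^ 2 - a * ⟪L (L (L v)), L (L v)⟫_ℝ) +
        l * (⟪L (L v), L v⟫_ℝ - a * ‖L (L v)‖ ^ 2)) := by positivity
  linarith

/-- The factor `1 - a r` is pulled out as in `norm_sub_smul_add_le`. The step that remains has size
`a / (1 - a r) ≥ a`, and `form_mono` gives back the excess. -/
theorem form_step_le (hL : BoundedPositive L k) {l s a r : ℝ} (hl : 0 ≤ l) (hs : 0 ≤ s)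
    (ha : 0 ≤ a) (hr : 0 ≤ r) (hk : 0 ≤ k) (har : a * (k + r) < 1) (v : H) :
    form L l (s + 2 * a) (v - a • (L v + r • v)) ≤ (1 - a * r) ^ 2 * form L l s v := by
  have hak : 0 ≤ a * k := mul_nonneg ha hk
  have h1 : 0 < 1 - a * r := by nlinarith
  have h2 : v - a • (L v + r • v) = (1 - a * r) • (v - (a / (1 - a * r)) • L v) := by
    rw [smul_sub, smul_smul, mul_div_cancel₀ _ h1.ne', smul_add, smul_smul, sub_smul, one_smul]
    abel
  have h3 : a ≤ a / (1 - a * r) := by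
    rw [le_div_iff₀ h1]
    nlinarith [mul_nonneg ha (mul_nonneg ha hr)]
  have h4 : a / (1 - a * r) * k ≤ 1 := by
    rw [div_mul_eq_mul_div, div_le_one h1]
    nlinarith
  rw [h2, form_smul]
  refine mul_le_mul_of_nonneg_left ?_ (sq_nonneg _)
  exact (hL.form_mono hl (by linarith) _).trans
    (hL.form_sub_smul_le hl hs (by positivity) h4 v)

/-- The polynomial `∏ (1 - a_k (X + r))`. -/
def stepPoly (r : ℝ) (a : ℕ → ℝ) (S : Finset ℕ) : Polynomial ℝ :=
  ∏ i ∈ S, (1 - Polynomial.C (a i) * (Polynomial.X + Polynomial.C r))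

/-- The operator `∏ (1 - a_k (L + r))`. -/
def stepProd (L : H →L[ℝ] H) (r : ℝ) (a : ℕ → ℝ) (S : Finset ℕ) : H →L[ℝ] H :=
  Polynomial.aeval L (stepPoly r a S)

@[simp]
theorem stepProd_empty (r : ℝ) (a : ℕ → ℝ) : stepProd L r a ∅ = 1 := by
  simp [stepProd, stepPoly]

theorem aeval_step (r a : ℝ) (x : H) :
    Polynomial.aeval L (1 - Polynomial.C a * (Polynomial.X + Polynomial.C r)) x
      = x - a • (L x + r • x) := by
  simp [Algebra.algebraMap_eq_smul_one]

/-- Because the product is a polynomial in `L`, any factor can be peeled off on either side,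
whatever the order of the indices. -/
theorem stepProd_insert_left (r : ℝ) (a : ℕ → ℝ) {S : Finset ℕ} {i : ℕ} (hi : i ∉ S) (x : H) :
    stepProd L r a (insert i S) x = stepProd L r a S x
      - a i • (L (stepProd L r a S x) + r • stepProd L r a S x) := by
  rw [← aeval_step, stepProd, stepPoly, Finset.prod_insert hi, map_mul]
  rfl

theorem stepProd_insert_right (r : ℝ) (a : ℕ → ℝ) {S : Finset ℕ} {i : ℕ} (hi : i ∉ S) (x : H) :
    stepProd L r a (insert i S) x = stepProd L r a S (x - a i • (L x + r • x)) := by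
  rw [← aeval_step, stepProd, stepPoly, Finset.prod_insert hi, mul_comm, map_mul]
  rfl

theorem stepProd_comm (r : ℝ) (a : ℕ → ℝ) (S : Finset ℕ) (x : H) :
    stepProd L r a S (L x) = L (stepProd L r a S x) := by
  have h := congrArg (fun T : H →L[ℝ] H => T x)
    (show Polynomial.aeval L (stepPoly r a S * Polynomial.X)
      = Polynomial.aeval L (Polynomial.X * stepPoly r a S) by rw [mul_comm])
  simpa [map_mul, stepProd] using h

theorem stepProd_symm (hL : BoundedPositive L k) (r : ℝ) (a : ℕ → ℝ) (S : Finset ℕ) (x y : H) :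
    ⟪stepProd L r a S x, y⟫_ℝ = ⟪x, stepProd L r a S y⟫_ℝ := by
  induction S using Finset.induction_on generalizing x y with
  | empty => simp
  | insert i S hi ih =>
    rw [stepProd_insert_left _ _ hi, stepProd_insert_right _ _ hi, ← ih]
    simp only [inner_sub_left, inner_sub_right, inner_add_left, inner_add_right, inner_smul_left,
      inner_smul_right, RCLike.conj_to_real, hL.symm]

theorem norm_stepProd_le (hL : BoundedPositive L k) (hk : 0 ≤ k) {r : ℝ} {a : ℕ → ℝ}
    {S : Finset ℕ} (ha : ∀ i ∈ S, 0 ≤ a i ∧ a i * (k + r) < 1) (x : H) :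
    ‖stepProd L r a S x‖ ≤ (∏ i ∈ S, (1 - a i * r)) * ‖x‖ := by
  induction S using Finset.induction_on with
  | empty => simp
  | insert i S hi ih =>
    have hai := ha i (Finset.mem_insert_self i S)
    have h1 : 0 ≤ 1 - a i * r := by nlinarith [mul_nonneg hai.1 hk]
    rw [stepProd_insert_left _ _ hi, Finset.prod_insert hi, mul_assoc]
    refine (hL.norm_sub_smul_add_le hai.1 hai.2 hk _).trans ?_
    exact mul_le_mul_of_nonneg_left (ih fun j hj => ha j (Finset.mem_insert_of_mem hj)) h1

theorem form_stepProd_le (hL : BoundedPositive L k) (hk : 0 ≤ k) {l r : ℝ} (hl : 0 ≤ l)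
    (hr : 0 ≤ r) {a : ℕ → ℝ} {S : Finset ℕ} (ha : ∀ i ∈ S, 0 ≤ a i ∧ a i * (k + r) < 1) (v : H) :
    form L l (2 * ∑ i ∈ S, a i) (stepProd L r a S v)
      ≤ (∏ i ∈ S, (1 - a i * r)) ^ 2 * form L l 0 v := by
  induction S using Finset.induction_on with
  | empty => simp
  | insert i S hi ih =>
    have hai := ha i (Finset.mem_insert_self i S)
    have haS : ∀ j ∈ S, 0 ≤ a j ∧ a j * (k + r) < 1 :=
      fun j hj => ha j (Finset.mem_insert_of_mem hj)
    have hs : 0 ≤ 2 * ∑ j ∈ S, a j :=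
      mul_nonneg zero_le_two (Finset.sum_nonneg fun j hj => (haS j hj).1)
    rw [stepProd_insert_left _ _ hi, Finset.prod_insert hi, Finset.sum_insert hi,
      mul_add, add_comm (2 * a i), mul_pow, mul_assoc]
    refine (hL.form_step_le hl hs hai.1 hr hk hai.2 _).trans ?_
    exact mul_le_mul_of_nonneg_left (ih haS) (sq_nonneg _)

/-- With `s = 2 ∑ a_k`, one has `L ∏ (1 - a_k (L + r))² ≤ ∏ (1 - a_k r)² s⁻¹ L (L + s⁻¹)⁻¹`. -/
theorem inner_stepProd_le (hL : BoundedPositive L k) (hk : 0 ≤ k) {s r : ℝ}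
    (hr : 0 ≤ r) {a : ℕ → ℝ} {S : Finset ℕ} (ha : ∀ i ∈ S, 0 ≤ a i ∧ a i * (k + r) < 1)
    (hs : s = 2 * ∑ i ∈ S, a i) (hs0 : 0 < s) {u x : H} (hu : L u + s⁻¹ • u = x) :
    ⟪L (stepProd L r a S x), stepProd L r a S x⟫_ℝ
      ≤ (∏ i ∈ S, (1 - a i * r)) ^ 2 * s⁻¹ * ⟪L u, x⟫_ℝ := by
  -- With `l = s⁻¹` one has `1 + s L = s (L + l)`. At `u = (L + l)⁻¹ x` the left side therefore
  -- becomes `s ⟪L P x, P x⟫`, where `P` is the product of the steps.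
  have h := hL.form_stepProd_le hk (inv_nonneg.2 hs0.le) hr ha u
  rw [← hs] at h
  have h1 : form L s⁻¹ 0 u = ⟪L u, x⟫_ℝ := by rw [form, zero_smul, add_zero, hu]
  have h2 : form L s⁻¹ s (stepProd L r a S u)
      = s * ⟪L (stepProd L r a S x), stepProd L r a S x⟫_ℝ := by
    have h3 : stepProd L r a S x = L (stepProd L r a S u) + s⁻¹ • stepProd L r a S u := by
      rw [← hu, map_add, map_smul, stepProd_comm]
    have h4 : L (stepProd L r a S u) + s • L (L (stepProd L r a S u))
        = s • L (stepProd L r a S x) := by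
      rw [h3, map_add, map_smul, smul_add, smul_smul, mul_inv_cancel₀ hs0.ne', one_smul, add_comm]
    rw [form, h4, ← h3, inner_smul_left, RCLike.conj_to_real]
  rw [h1, h2] at h
  rw [mul_right_comm, ← div_eq_mul_inv, le_div_iff₀ hs0]
  linarith

/-- In the expansion of `‖L u + l u‖²` the cross term is nonnegative, so each square is at most the
whole. -/
theorem norm_le_of_add_smul_eq (hL : BoundedPositive L k) {l : ℝ} (hl : 0 ≤ l) {u x : H}
    (hu : L u + l • u = x) : ‖L u‖ ≤ ‖x‖ ∧ l * ‖u‖ ≤ ‖x‖ := by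
  have h : ‖x‖ ^ 2 = ‖L u‖ ^ 2 + 2 * l * ⟪L u, u⟫_ℝ + (l * ‖u‖) ^ 2 := by
    rw [← hu, norm_add_sq_real, inner_smul_right, norm_smul, Real.norm_of_nonneg hl]
    ring
  have h1 := mul_nonneg hl (hL.nonneg u)
  exact ⟨le_of_sq_le_sq (by nlinarith [sq_nonneg (l * ‖u‖)]) (norm_nonneg _),
    le_of_sq_le_sq (by nlinarith [sq_nonneg ‖L u‖]) (norm_nonneg _)⟩

theorem eq_of_add_smul_eq (hL : BoundedPositive L k) {l : ℝ} (hl : 0 < l) {u v : H}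
    (h : L u + l • u = L v + l • v) : u = v := by
  have h1 : L (u - v) + l • (u - v) = 0 := by
    rw [map_sub, smul_sub, sub_add_sub_comm, h, sub_self]
  have h2 := (hL.norm_le_of_add_smul_eq hl.le h1).2
  rw [norm_zero] at h2
  have h3 : ‖u - v‖ ≤ 0 := by
    by_contra hc
    push Not at hc
    nlinarith
  exact sub_eq_zero.1 (norm_le_zero_iff.1 h3)

/-! #### Resolvents -/

variable [CompleteSpace H]

theorem isUnit_add_smul (hL : BoundedPositive L k) {l : ℝ} (hl : 0 < l) :
    IsUnit (L + l • ContinuousLinearMap.id ℝ H) := by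
  refine ContinuousLinearMap.isUnit_of_forall_le_norm_inner_map _ (c := ⟨l, hl.le⟩) hl fun x => ?_
  refine le_trans ?_ (le_abs_self _)
  have := hL.nonneg x
  change ‖x‖ ^ 2 * l ≤ _
  simp only [add_apply, smul_apply,
    ContinuousLinearMap.id_apply, inner_add_left, inner_smul_left, real_inner_self_eq_norm_sq,
    RCLike.conj_to_real]
  linarith

theorem resolvent_apply (hL : BoundedPositive L k) {l : ℝ} (hl : 0 < l) (x : H) :
    L (Ring.inverse (L + l • ContinuousLinearMap.id ℝ H) x)
      + l • Ring.inverse (L + l • ContinuousLinearMap.id ℝ H) x = x := by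
  have h := congrArg (fun T : H →L[ℝ] H => T x) (Ring.mul_inverse_cancel _ (hL.isUnit_add_smul hl))
  simpa using h

/-! #### Spectral powers -/

/-- The orthogonal projection onto the eigenspace of `L` at `σ`. -/
def eigenProj (L : H →L[ℝ] H) (σ : ℝ) : H →L[ℝ] H :=
  (L - σ • ContinuousLinearMap.id ℝ H).ker.starProjection

theorem apply_eigenProj (σ : ℝ) (x : H) : L (eigenProj L σ x) = σ • eigenProj L σ x := by
  have h : eigenProj L σ x ∈ (L - σ • ContinuousLinearMap.id ℝ H).ker :=
    Submodule.starProjection_apply_mem _ x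
  rw [LinearMap.mem_ker] at h
  simpa [sub_eq_zero] using h

theorem inner_eigenProj_self (σ : ℝ) (x : H) : ⟪eigenProj L σ x, x⟫_ℝ = ‖eigenProj L σ x‖ ^ 2 := by
  have := Submodule.starProjection_inner_eq_zero
    (K := (L - σ • ContinuousLinearMap.id ℝ H).ker) x (eigenProj L σ x)
    (Submodule.starProjection_apply_mem _ x)
  rw [← real_inner_self_eq_norm_sq, real_inner_comm, ← sub_eq_zero, ← inner_sub_left]
  exact this

theorem inner_eigenProj_eq_zero (hL : BoundedPositive L k) {σ τ : ℝ} (h : σ ≠ τ) (x y : H) :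
    ⟪eigenProj L σ x, eigenProj L τ y⟫_ℝ = 0 := by
  have h1 := hL.symm (eigenProj L σ x) (eigenProj L τ y)
  rw [apply_eigenProj, apply_eigenProj, inner_smul_left, inner_smul_right,
    RCLike.conj_to_real] at h1
  have h2 : (σ - τ) * ⟪eigenProj L σ x, eigenProj L τ y⟫_ℝ = 0 := by linarith
  exact (mul_eq_zero.1 h2).resolve_left (sub_ne_zero.2 h)

theorem eigenProj_of_neg (hL : BoundedPositive L k) {σ : ℝ} (h : σ < 0) (x : H) :
    eigenProj L σ x = 0 := by
  have h1 := hL.nonneg (eigenProj L σ x)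
  rw [apply_eigenProj, inner_smul_left, real_inner_self_eq_norm_sq, RCLike.conj_to_real] at h1
  by_contra hx
  have : 0 < ‖eigenProj L σ x‖ ^ 2 := by positivity
  nlinarith

theorem norm_sq_sum_eigenProj (hL : BoundedPositive L k) (c : ℝ → ℝ) (s : Finset ℝ) (x : H) :
    ‖∑ σ ∈ s, c σ • eigenProj L σ x‖ ^ 2 = ∑ σ ∈ s, c σ ^ 2 * ‖eigenProj L σ x‖ ^ 2 := by
  rw [← real_inner_self_eq_norm_sq, sum_inner]
  refine Finset.sum_congr rfl fun σ hσ => ?_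
  rw [inner_sum, Finset.sum_eq_single σ]
  · rw [inner_smul_left, inner_smul_right, real_inner_self_eq_norm_sq, RCLike.conj_to_real]
    ring
  · intro τ _ hτ
    rw [inner_smul_left, inner_smul_right, hL.inner_eigenProj_eq_zero hτ.symm]
    simp
  · exact fun h => absurd hσ h

/-- Bessel's inequality for the mutually orthogonal eigenspaces. -/
theorem sum_norm_sq_eigenProj_le (hL : BoundedPositive L k) (s : Finset ℝ) (x : H) :
    ∑ σ ∈ s, ‖eigenProj L σ x‖ ^ 2 ≤ ‖x‖ ^ 2 := by
  have h1 := hL.norm_sq_sum_eigenProj (fun _ => 1) s x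
  simp only [one_smul, one_pow, one_mul] at h1
  have h2 : ⟪∑ σ ∈ s, eigenProj L σ x, x⟫_ℝ = ‖∑ σ ∈ s, eigenProj L σ x‖ ^ 2 := by
    rw [sum_inner, h1]
    exact Finset.sum_congr rfl fun σ _ => inner_eigenProj_self σ x
  have h3 := real_inner_le_norm (∑ σ ∈ s, eigenProj L σ x) x
  rw [h2] at h3
  rw [← h1]
  have h4 := norm_nonneg (∑ σ ∈ s, eigenProj L σ x)
  have h5 := norm_nonneg x
  by_contra hc
  push Not at hc
  nlinarith [lt_of_pow_lt_pow_left₀ 2 h4 hc]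

theorem norm_sum_eigenProj_le (hL : BoundedPositive L k) {c : ℝ → ℝ} {M : ℝ} (hM : 0 ≤ M)
    (s : Finset ℝ) (x : H) (hc : ∀ σ, 0 ≤ σ → |c σ| ≤ M) :
    ‖∑ σ ∈ s, c σ • eigenProj L σ x‖ ≤ M * ‖x‖ := by
  refine le_of_sq_le_sq ?_ (by positivity)
  rw [hL.norm_sq_sum_eigenProj, mul_pow]
  refine le_trans ?_ (mul_le_mul_of_nonneg_left (hL.sum_norm_sq_eigenProj_le s x) (sq_nonneg M))
  rw [Finset.mul_sum]
  refine Finset.sum_le_sum fun σ _ => ?_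
  rcases lt_or_ge σ 0 with h | h
  · simp [hL.eigenProj_of_neg h]
  · refine mul_le_mul_of_nonneg_right ?_ (sq_nonneg _)
    rw [← sq_abs]
    exact pow_le_pow_left₀ (abs_nonneg _) (hc σ h) 2

/-- In terms of the ratio `r = σ / l` this is `r^z ≤ r + 1`. Here `z ≤ 1` matters: it is the
saturation of Tikhonov regularization. -/
theorem mul_rpow_div_le {l σ z : ℝ} (hl : 0 < l) (hσ : 0 ≤ σ) (hz : 0 < z) (hz1 : z ≤ 1) :
    l * σ ^ z / (σ + l) ≤ l ^ z := by
  rw [div_le_iff₀ (by positivity)]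
  have h1 : 0 ≤ σ / l := by positivity
  have h2 : (σ / l) ^ z ≤ σ / l + 1 := by
    rcases le_total (σ / l) 1 with h | h
    · exact (Real.rpow_le_one h1 h hz.le).trans (by linarith)
    · exact (Real.rpow_le_rpow_of_exponent_le h hz1).trans (by rw [Real.rpow_one]; linarith)
  have h3 : σ ^ z = l ^ z * (σ / l) ^ z := by
    rw [← Real.mul_rpow hl.le h1, mul_div_cancel₀ _ hl.ne']
  rw [h3]
  calc l * (l ^ z * (σ / l) ^ z) = l ^ z * (l * (σ / l) ^ z) := by ring
    _ ≤ l ^ z * (l * (σ / l + 1)) := by gcongr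
    _ = l ^ z * (σ + l) := by rw [mul_add, mul_div_cancel₀ _ hl.ne', mul_one]

/-- If `(L + l) u = L^z g` with `0 < z ≤ 1`, then `‖l u‖ ≤ l^z ‖g‖`. -/
theorem norm_resolvent_spectralPower_le (hL : BoundedPositive L k) {l z : ℝ} (hl : 0 < l)
    (hz : 0 < z) (hz1 : z ≤ 1) {u g : H} (hu : L u + l • u = spectralPower L z g) :
    l * ‖u‖ ≤ l ^ z * ‖g‖ := by
  set R := Ring.inverse (L + l • ContinuousLinearMap.id ℝ H) with hR
  have hRu : R (spectralPower L z g) = u :=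
    hL.eq_of_add_smul_eq hl ((hL.resolvent_apply hl _).trans hu.symm)
  -- If the family is not summable, the `tsum` defining `spectralPower` takes the default value `0`,
  -- hence `u = 0`. Otherwise the resolvent acts termwise on eigenvectors.
  by_cases hs : Summable fun σ : ℝ => σ ^ z • eigenProj L σ g
  · have h1 : HasSum (fun σ : ℝ => l • R (σ ^ z • eigenProj L σ g)) (l • u) := by
      rw [← hRu]
      exact (hs.hasSum.mapL R).const_smul l
    have h2 : ∀ σ : ℝ, l • R (σ ^ z • eigenProj L σ g)
        = (l * σ ^ z / (σ + l)) • eigenProj L σ g := by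
      intro σ
      rcases lt_or_ge σ 0 with h | h
      · simp [hL.eigenProj_of_neg h]
      · have hp : σ + l ≠ 0 := by positivity
        have : R (eigenProj L σ g) = (σ + l)⁻¹ • eigenProj L σ g := by
          refine hL.eq_of_add_smul_eq hl ((hL.resolvent_apply hl _).trans ?_)
          rw [map_smul, apply_eigenProj, smul_smul, smul_smul, ← add_smul, mul_comm, ← add_mul,
            mul_inv_cancel₀ hp, one_smul]
        rw [map_smul, this, smul_smul, smul_smul, div_eq_mul_inv, mul_assoc]
    simp only [h2] at h1
    have h3 : ‖l • u‖ ≤ l ^ z * ‖g‖ := by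
      refine le_of_tendsto h1.norm (Filter.Eventually.of_forall fun s => ?_)
      refine hL.norm_sum_eigenProj_le (by positivity) s g fun σ hσ => ?_
      rw [abs_of_nonneg (by positivity)]
      exact mul_rpow_div_le hl hσ hz hz1
    rwa [norm_smul, Real.norm_of_nonneg hl.le] at h3
  · have h0 : spectralPower L z g = 0 := tsum_eq_zero_of_not_summable hs
    have : u = 0 := by rw [← hRu, h0, map_zero]
    rw [this, norm_zero, mul_zero]
    positivity

end BoundedPositive

end PositiveOperators

/-! ### Random functions as random elements of `L²`. -/

section ClassInL2

/-- By second countability an open set is a countable union of balls, and preimages of balls are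
sublevel sets of distances. -/
theorem measurable_of_measurable_dist {Ω E : Type*} [MeasurableSpace Ω] [PseudoMetricSpace E]
    [SecondCountableTopology E] [MeasurableSpace E] [BorelSpace E] {f : Ω → E}
    (h : ∀ g, Measurable fun ω => dist (f ω) g) : Measurable f := by
  refine measurable_of_isOpen fun s hs => ?_
  have h1 : ∀ x : s, ∃ r > 0, Metric.ball (x : E) r ⊆ s := fun x => Metric.isOpen_iff.1 hs x x.2
  choose r hr hrs using h1
  obtain ⟨T, hT, hTs⟩ := TopologicalSpace.isOpen_iUnion_countable
    (fun x : s => Metric.ball (x : E) (r x)) fun x => Metric.isOpen_ball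
  have h2 : s = ⋃ x ∈ T, Metric.ball (x : E) (r x) := by
    rw [hTs]
    refine Set.Subset.antisymm (fun x hx => ?_) (Set.iUnion_subset hrs)
    exact Set.mem_iUnion.2 ⟨⟨x, hx⟩, Metric.mem_ball_self (hr _)⟩
  rw [h2, Set.preimage_iUnion₂]
  exact MeasurableSet.biUnion hT fun x _ => measurableSet_lt (h x) measurable_const

variable {α : Type*} [MeasurableSpace α] {ν : Measure α}

open scoped Classical in
/-- The class of `f` in `L²(ν)`, and `0` if `f` is not square-integrable. -/
def toL2 (ν : Measure α) (f : α → ℝ) : Lp ℝ 2 ν := if h : MemLp f 2 ν then h.toLp f else 0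

theorem toL2_of_memLp {f : α → ℝ} (h : MemLp f 2 ν) : toL2 ν f = h.toLp f := dif_pos h

theorem coeFn_toL2 {f : α → ℝ} (h : MemLp f 2 ν) : toL2 ν f =ᵐ[ν] f := by
  rw [toL2_of_memLp h]
  exact h.coeFn_toLp

theorem inner_toL2 {f : α → ℝ} (h : MemLp f 2 ν) (g : Lp ℝ 2 ν) :
    ⟪toL2 ν f, g⟫_ℝ = ∫ x, f x * g x ∂ν := by
  rw [L2.inner_def]
  refine integral_congr_ae ?_
  filter_upwards [coeFn_toL2 h] with x hx
  rw [hx]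
  simp [mul_comm]

theorem norm_sq_eq_integral (g : Lp ℝ 2 ν) : ‖g‖ ^ 2 = ∫ x, g x ^ 2 ∂ν := by
  rw [← real_inner_self_eq_norm_sq, L2.inner_def]
  refine integral_congr_ae (Filter.Eventually.of_forall fun x => ?_)
  simp [sq]

theorem norm_toL2_sq {f : α → ℝ} (h : MemLp f 2 ν) : ‖toL2 ν f‖ ^ 2 = ∫ x, f x ^ 2 ∂ν := by
  rw [norm_sq_eq_integral]
  refine integral_congr_ae ?_
  filter_upwards [coeFn_toL2 h] with x hx
  rw [hx]

theorem enorm_toL2_sub {f : α → ℝ} (h : MemLp f 2 ν) (g : Lp ℝ 2 ν) :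
    ‖toL2 ν f - g‖ₑ = eLpNorm (fun x => f x - g x) 2 ν := by
  rw [Lp.enorm_def]
  refine eLpNorm_congr_ae ?_
  filter_upwards [Lp.coeFn_sub (toL2 ν f) g, coeFn_toL2 h] with x h1 h2
  rw [h1, Pi.sub_apply, h2]

/-- A single good point `x` with `h x > c` forces `h y ≤ c` for almost every `y`; without such a
point `h ≤ c` almost everywhere at once. The same holds for `-h`. This turns the bound on `φ_v(x)
φ_v(x')` into `|φ_v| ≤ κ`. -/
theorem abs_le_of_ae_mul_le {h : α → ℝ} {c : ℝ} (hc : 0 ≤ c)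
    (H : ∀ᵐ x ∂ν, ∀ᵐ y ∂ν, h x * h y ≤ c ^ 2) : ∀ᵐ x ∂ν, |h x| ≤ c := by
  have key : ∀ {h : α → ℝ}, (∀ᵐ x ∂ν, ∀ᵐ y ∂ν, h x * h y ≤ c ^ 2) → ∀ᵐ x ∂ν, h x ≤ c := by
    intro h H
    by_cases hx : ∃ x, c < h x ∧ ∀ᵐ y ∂ν, h x * h y ≤ c ^ 2
    · obtain ⟨x, hx, hy⟩ := hx
      filter_upwards [hy] with y hy
      by_contra hc'
      push Not at hc'
      nlinarith
    · filter_upwards [H] with x hH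
      by_contra hc'
      push Not at hc'
      exact hx ⟨x, hc', hH⟩
  have H' : ∀ᵐ x ∂ν, ∀ᵐ y ∂ν, (-h x) * (-h y) ≤ c ^ 2 := by simpa using H
  filter_upwards [key H, key (h := fun x => -h x) H'] with x h1 h2
  exact abs_le.2 ⟨by linarith, h1⟩

variable {Ω : Type*} [MeasurableSpace Ω] [SFinite ν]

theorem measurable_eLpNorm_two {F : Ω → α → ℝ} (hF : Measurable (Function.uncurry F)) :
    Measurable fun ω => eLpNorm (F ω) 2 ν := by
  simp only [eLpNorm_eq_lintegral_rpow_enorm_toReal two_ne_zero ENNReal.ofNat_ne_top]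
  exact (Measurable.lintegral_prod_right' (f := fun p : Ω × α => ‖F p.1 p.2‖ₑ ^ (2 : ℝ≥0∞).toReal)
    (hF.enorm.pow_const _)).pow_const _

theorem measurableSet_memLp {F : Ω → α → ℝ} (hF : Measurable (Function.uncurry F)) :
    MeasurableSet {ω | MemLp (F ω) 2 ν} := by
  have : {ω | MemLp (F ω) 2 ν} = {ω | eLpNorm (F ω) 2 ν < ∞} := by
    ext ω
    exact ⟨fun h => h.2, fun h => ⟨(hF.comp measurable_prodMk_left).aestronglyMeasurable, h⟩⟩
  rw [this]
  exact measurableSet_lt (measurable_eLpNorm_two hF) measurable_const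

theorem stronglyMeasurable_toL2 [SecondCountableTopology (Lp ℝ 2 ν)] {F : Ω → α → ℝ}
    (hF : Measurable (Function.uncurry F)) : StronglyMeasurable fun ω => toL2 ν (F ω) := by
  classical
  let _ : MeasurableSpace (Lp ℝ 2 ν) := borel _
  have _ : BorelSpace (Lp ℝ 2 ν) := ⟨rfl⟩
  refine Measurable.stronglyMeasurable (measurable_of_measurable_dist fun g => ?_)
  -- Distances to a fixed `g` are explicit integrals on the measurable set where `F ω` is
  -- square-integrable, and constant off it, where `toL2` is `0`.
  have h1 : ∀ ω, dist (toL2 ν (F ω)) g = if MemLp (F ω) 2 ν then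
      (eLpNorm (fun x => F ω x - g x) 2 ν).toReal else ‖g‖ := by
    intro ω
    split_ifs with h
    · rw [← enorm_toL2_sub h, dist_eq_norm, toReal_enorm]
    · rw [toL2, dif_neg h, dist_zero_left]
  simp only [h1]
  refine Measurable.ite (measurableSet_memLp hF) ?_ measurable_const
  refine (measurable_eLpNorm_two (F := fun ω x => F ω x - g x) ?_).ennreal_toReal
  exact hF.sub ((Lp.stronglyMeasurable g).measurable.comp measurable_snd)

end ClassInL2

/-! ### Hilbert bases and Parseval's identity. -/

section HilbertBases

variable {H : Type*} [NormedAddCommGroup H] [InnerProductSpace ℝ H]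

/-- Distinct orthonormal vectors are `√2` apart, so the balls of radius `1/2` around them are
disjoint. Countability allows sum and integral to be exchanged in the trace formula. -/
theorem Orthonormal.countable_index [SecondCountableTopology H] {ι : Type*} {b : ι → H}
    (hb : Orthonormal ℝ b) : Countable ι := by
  have h1 : ∀ i j, i ≠ j → 1 ≤ ‖b i - b j‖ := by
    intro i j hij
    have : ‖b i - b j‖ ^ 2 = 2 := by
      rw [norm_sub_sq_real, hb.1, hb.1, hb.2 hij]
      norm_num
    nlinarith [norm_nonneg (b i - b j)]
  have h2 : (Set.univ : Set ι).PairwiseDisjoint fun i => Metric.ball (b i) (1 / 2) := by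
    intro i _ j _ hij
    refine Metric.ball_disjoint_ball ?_
    rw [dist_eq_norm]
    linarith [h1 i j hij]
  exact Set.countable_univ_iff.1 (h2.countable_of_isOpen (fun i _ => Metric.isOpen_ball)
    fun i _ => Metric.nonempty_ball.2 (by norm_num))

theorem HilbertBasis.ofReal_norm_sq {ι : Type*} (b : HilbertBasis ι ℝ H) (x : H) :
    ENNReal.ofReal (‖x‖ ^ 2) = ∑' i, ENNReal.ofReal (⟪b i, x⟫_ℝ ^ 2) := by
  have h := b.hasSum_inner_mul_inner x x
  rw [real_inner_self_eq_norm_sq] at h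
  have h1 : HasSum (fun i => ⟪b i, x⟫_ℝ ^ 2) (‖x‖ ^ 2) := by
    simpa only [real_inner_comm x, ← sq] using h
  rw [← h1.tsum_eq, ENNReal.ofReal_tsum_of_nonneg (fun i => sq_nonneg _) h1.summable]

end HilbertBases

/-! ### Features, `L_K` as their second moment, and the trace bound. -/

namespace Problem

variable {α V : Type*} [MeasurableSpace α] [MeasurableSpace V] (P : Problem α V) {κ : ℝ}

/-- The feature `φ_v` as an element of `L²(ρ_X)`. -/
def feature (v : V) : Lp ℝ 2 P.ρX := toL2 P.ρX (P.φ v)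

theorem measurable_section (v : V) : Measurable (P.φ v) :=
  P.φ_measurable.comp measurable_prodMk_left

theorem ae_memLp_feature : ∀ᵐ v ∂P.μ, MemLp (P.φ v) 2 P.ρX := by
  filter_upwards [P.φ_memLp.integrable_sq.prod_right_ae] with v h
  exact (memLp_two_iff_integrable_sq (P.measurable_section v).aestronglyMeasurable).2 h

theorem BoundedBy.ae_abs_le {P : Problem α V} (hκ : 0 ≤ κ) (h : P.BoundedBy κ) :
    ∀ᵐ v ∂P.μ, ∀ᵐ x ∂P.ρX, |P.φ v x| ≤ κ := by
  filter_upwards [Measure.ae_ae_of_ae_prod h.2] with v hv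
  exact abs_le_of_ae_mul_le hκ (Measure.ae_ae_of_ae_prod hv)

theorem BoundedBy.ae_prod_abs_le {P : Problem α V} (hκ : 0 ≤ κ) (h : P.BoundedBy κ) :
    ∀ᵐ p ∂(P.μ.prod P.ρX), |P.φ p.1 p.2| ≤ κ := by
  refine (Measure.ae_prod_iff_ae_ae ?_).2 (h.ae_abs_le hκ)
  exact measurableSet_le (continuous_abs.measurable.comp P.φ_measurable) measurable_const

theorem BoundedBy.ae_norm_feature_le {P : Problem α V} (hκ : 0 ≤ κ) (h : P.BoundedBy κ) :
    ∀ᵐ v ∂P.μ, ‖P.feature v‖ ≤ κ := by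
  filter_upwards [h.ae_abs_le hκ, P.ae_memLp_feature] with v h1 h2
  refine le_of_sq_le_sq ?_ hκ
  rw [feature, norm_toL2_sq h2]
  have : ∫ x, P.φ v x ^ 2 ∂P.ρX ≤ ∫ _, κ ^ 2 ∂P.ρX := by
    refine integral_mono_ae h2.integrable_sq (integrable_const _) ?_
    filter_upwards [h1] with x hx
    rw [← sq_abs]
    exact pow_le_pow_left₀ (abs_nonneg _) hx 2
  simpa using this

theorem ae_inner_feature (g : Lp ℝ 2 P.ρX) :
    ∀ᵐ v ∂P.μ, ⟪P.feature v, g⟫_ℝ = ∫ x, P.φ v x * g x ∂P.ρX := by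
  filter_upwards [P.ae_memLp_feature] with v h
  exact inner_toL2 h g

/-- This is `L_K = 𝔼 φ_v ⊗ φ_v`, by Fubini; the integrand is dominated by `κ² |g'(x) g(u)|`. -/
theorem inner_LK {P : Problem α V} (hκ : 0 ≤ κ) (h : P.BoundedBy κ) (g g' : Lp ℝ 2 P.ρX) :
    ⟪P.LK g, g'⟫_ℝ = ∫ v, ⟪P.feature v, g⟫_ℝ * ⟪P.feature v, g'⟫_ℝ ∂P.μ := by
  have hg : ∀ g : Lp ℝ 2 P.ρX, Integrable (fun x => g x) P.ρX :=
    fun g => (Lp.memLp g).integrable (by norm_num)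
  have hint : Integrable (fun q : V × (α × α) =>
      P.φ q.1 q.2.1 * g' q.2.1 * (P.φ q.1 q.2.2 * g q.2.2)) (P.μ.prod (P.ρX.prod P.ρX)) := by
    have h1 : Integrable (fun q : V × (α × α) => κ ^ 2 * ‖g' q.2.1 * g q.2.2‖)
        (P.μ.prod (P.ρX.prod P.ρX)) :=
      (((hg g').mul_prod (hg g)).comp_snd P.μ).norm.const_mul _
    have hm1 : Measurable fun q : V × (α × α) => P.φ q.1 q.2.1 :=
      P.φ_measurable.comp (measurable_fst.prodMk (measurable_fst.comp measurable_snd))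
    have hm2 : Measurable fun q : V × (α × α) => P.φ q.1 q.2.2 :=
      P.φ_measurable.comp (measurable_fst.prodMk (measurable_snd.comp measurable_snd))
    refine h1.mono' ?_ ?_
    · refine Measurable.aestronglyMeasurable ?_
      have h3 := (Lp.stronglyMeasurable g).measurable
      have h4 := (Lp.stronglyMeasurable g').measurable
      exact (hm1.mul (h4.comp (measurable_fst.comp measurable_snd))).mul
        (hm2.mul (h3.comp (measurable_snd.comp measurable_snd)))
    · have h5 : ∀ᵐ q ∂(P.μ.prod (P.ρX.prod P.ρX)), |P.φ q.1 q.2.1| ≤ κ ∧ |P.φ q.1 q.2.2| ≤ κ := by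
        refine (Measure.ae_prod_iff_ae_ae ?_).2 ?_
        · exact (measurableSet_le hm1.abs measurable_const).inter
            (measurableSet_le hm2.abs measurable_const)
        · filter_upwards [h.ae_abs_le hκ] with v hv
          exact (Measure.quasiMeasurePreserving_fst.ae hv).and
            (Measure.quasiMeasurePreserving_snd.ae hv)
      filter_upwards [h5] with q hq
      rw [show P.φ q.1 q.2.1 * g' q.2.1 * (P.φ q.1 q.2.2 * g q.2.2)
        = (P.φ q.1 q.2.1 * P.φ q.1 q.2.2) * (g' q.2.1 * g q.2.2) by ring, norm_mul]
      refine mul_le_mul_of_nonneg_right ?_ (norm_nonneg _)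
      rw [norm_mul, sq, Real.norm_eq_abs, Real.norm_eq_abs]
      exact mul_le_mul hq.1 hq.2 (abs_nonneg _) hκ
  have hR : ∫ v, ⟪P.feature v, g⟫_ℝ * ⟪P.feature v, g'⟫_ℝ ∂P.μ
      = ∫ v, ∫ p, P.φ v p.1 * g' p.1 * (P.φ v p.2 * g p.2) ∂(P.ρX.prod P.ρX) ∂P.μ := by
    refine integral_congr_ae ?_
    filter_upwards [P.ae_inner_feature g, P.ae_inner_feature g'] with v h1 h2
    rw [h1, h2, mul_comm, ← integral_prod_mul]
  have hL : ⟪P.LK g, g'⟫_ℝ = ∫ x, (∫ u, P.K x u * g u ∂P.ρX) * g' x ∂P.ρX := by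
    rw [← inner_toL2 (memLp_integral_kernel P.memLp_K g) g',
      toL2_of_memLp (memLp_integral_kernel P.memLp_K g)]
    rfl
  rw [hR, integral_integral_swap hint, integral_prod _ hint.integral_prod_right, hL]
  refine integral_congr_ae (Filter.Eventually.of_forall fun x => ?_)
  simp only
  rw [← integral_mul_const]
  refine integral_congr_ae (Filter.Eventually.of_forall fun u => ?_)
  simp only
  rw [P.K_eq, ← integral_mul_const, ← integral_mul_const]
  refine integral_congr_ae (Filter.Eventually.of_forall fun v => ?_)
  simp only
  ring

variable [SecondCountableTopology (Lp ℝ 2 P.ρX)]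

theorem stronglyMeasurable_feature : StronglyMeasurable P.feature :=
  stronglyMeasurable_toL2 P.φ_measurable

variable {P} in
theorem BoundedBy.memLp_feature (hκ : 0 ≤ κ) (h : P.BoundedBy κ) (p : ℝ≥0∞) :
    MemLp P.feature p P.μ :=
  MemLp.of_bound P.stronglyMeasurable_feature.aestronglyMeasurable κ (h.ae_norm_feature_le hκ)

variable {P} in
theorem integrable_inner_feature_sq (hκ : 0 ≤ κ) (h : P.BoundedBy κ) (g : Lp ℝ 2 P.ρX) :
    Integrable (fun v => ⟪P.feature v, g⟫_ℝ ^ 2) P.μ :=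
  ((h.memLp_feature hκ 2).inner_const g).integrable_sq

variable {P} in
theorem boundedPositive_LK (hκ : 0 ≤ κ) (h : P.BoundedBy κ) :
    BoundedPositive P.LK (κ ^ 2) where
  symm g g' := by
    rw [real_inner_comm (P.LK g') g, inner_LK hκ h, inner_LK hκ h]
    simp only [mul_comm]
  nonneg g := by
    rw [inner_LK hκ h]
    exact integral_nonneg fun v => mul_self_nonneg _
  le g := by
    rw [inner_LK hκ h]
    have : ∫ v, ⟪P.feature v, g⟫_ℝ ^ 2 ∂P.μ ≤ ∫ _, κ ^ 2 * ‖g‖ ^ 2 ∂P.μ := by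
      refine integral_mono_ae (integrable_inner_feature_sq hκ h g) (integrable_const _) ?_
      filter_upwards [h.ae_norm_feature_le hκ] with v hv
      rw [← mul_pow, ← sq_abs]
      exact pow_le_pow_left₀ (abs_nonneg _)
        ((abs_real_inner_le_norm _ _).trans (mul_le_mul_of_nonneg_right hv (norm_nonneg _))) 2
    simpa [sq] using this

variable {P} in
/-- `𝔼 ‖A φ_v‖² = tr (A L_K A)` for symmetric `A`. -/
theorem lintegral_norm_sq_apply_feature (hκ : 0 ≤ κ) (h : P.BoundedBy κ)
    {A : Lp ℝ 2 P.ρX →L[ℝ] Lp ℝ 2 P.ρX} (hA : ∀ x y, ⟪A x, y⟫_ℝ = ⟪x, A y⟫_ℝ) {ι : Type*}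
    (b : HilbertBasis ι ℝ (Lp ℝ 2 P.ρX)) :
    ∫⁻ v, ENNReal.ofReal (‖A (P.feature v)‖ ^ 2) ∂P.μ
      = ∑' i, ENNReal.ofReal ⟪P.LK (A (b i)), A (b i)⟫_ℝ := by
  have := Orthonormal.countable_index b.orthonormal
  simp only [HilbertBasis.ofReal_norm_sq b]
  rw [lintegral_tsum]
  · refine tsum_congr fun i => ?_
    rw [inner_LK hκ h, ofReal_integral_eq_lintegral_ofReal]
    · refine lintegral_congr fun v => ?_
      rw [← hA, real_inner_comm, sq]
    · simpa [sq] using integrable_inner_feature_sq hκ h (A (b i))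
    · exact Filter.Eventually.of_forall fun v => mul_self_nonneg _
  · intro i
    refine AEMeasurable.ennreal_ofReal ?_
    refine AEMeasurable.pow_const ?_ 2
    exact ((stronglyMeasurable_const.inner (A.continuous.comp_stronglyMeasurable
      P.stronglyMeasurable_feature)).measurable).aemeasurable

variable {P} in
/-- The capacity condition bounds `𝔼 ‖∏ (1 - a_k (L_K + r)) φ_v‖²`. -/
theorem lintegral_norm_sq_stepProd_le {γ c : ℝ} (hκ : 0 ≤ κ) (h : P.BoundedBy κ)
    (hcap : P.CapacityBound γ c) {r : ℝ} (hr : 0 ≤ r) {a : ℕ → ℝ} {S : Finset ℕ}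
    (ha : ∀ i ∈ S, 0 ≤ a i ∧ a i * (κ ^ 2 + r) < 1) (hs : 0 < ∑ i ∈ S, a i) :
    ∫⁻ v, ENNReal.ofReal (‖BoundedPositive.stepProd P.LK r a S (P.feature v)‖ ^ 2) ∂P.μ
      ≤ ENNReal.ofReal ((∏ i ∈ S, (1 - a i * r)) ^ 2 * (c * (2 * ∑ i ∈ S, a i) ^ (γ - 1))) := by
  have hL := boundedPositive_LK hκ h
  set s := 2 * ∑ i ∈ S, a i with hsdef
  have hs0 : 0 < s := by positivity
  -- The capacity condition is used at level `s⁻¹`, and the trace is expanded in the very basis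
  -- chosen in `opTrace`, so the two sums compare term by term.
  have hcap' := hcap s⁻¹ (inv_pos.2 hs0)
  rw [effectiveDimension, opTrace] at hcap'
  rw [lintegral_norm_sq_apply_feature hκ h (hL.stepProd_symm r a S)
    (exists_hilbertBasis ℝ (Lp ℝ 2 P.ρX)).choose_spec.choose]
  have h1 : (∏ i ∈ S, (1 - a i * r)) ^ 2 * (c * s ^ (γ - 1))
      = (∏ i ∈ S, (1 - a i * r)) ^ 2 * s⁻¹ * (c * s⁻¹ ^ (-γ)) := by
    rw [Real.inv_rpow hs0.le, Real.rpow_neg hs0.le, inv_inv, Real.rpow_sub_one hs0.ne']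
    ring
  have h2 : 0 ≤ (∏ i ∈ S, (1 - a i * r)) ^ 2 * s⁻¹ := by positivity
  rw [h1, ENNReal.ofReal_mul h2]
  refine le_trans ?_ (mul_le_mul_right hcap' _)
  rw [← ENNReal.tsum_mul_left]
  refine ENNReal.tsum_le_tsum fun i => ?_
  rw [← ENNReal.ofReal_mul h2]
  refine ENNReal.ofReal_le_ofReal ?_
  rw [mul_apply_eq_comp]
  refine (hL.inner_stepProd_le (sq_nonneg κ) hr ha hsdef hs0
    (hL.resolvent_apply (inv_pos.2 hs0) _)).trans_eq ?_
  rw [real_inner_comm]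

end Problem

/-! ### One stochastic gradient step: mean, second moment and risk. -/

namespace Problem

variable {α V : Type*} [MeasurableSpace α] [MeasurableSpace V] (P : Problem α V) {κ : ℝ}

theorem measurePreserving_fst : MeasurePreserving Prod.fst P.ρ P.ρX := ⟨measurable_fst, rfl⟩

theorem memLp_snd : MemLp (fun z : α × ℝ => z.2) 2 P.ρ :=
  (memLp_two_iff_integrable_sq measurable_snd.aestronglyMeasurable).2 P.ρ_sq

theorem memLp_residual {f : α → ℝ} (hf : MemLp f 2 P.ρX) :
    MemLp (fun z : α × ℝ => f z.1 - z.2) 2 P.ρ :=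
  (hf.comp_measurePreserving P.measurePreserving_fst).sub P.memLp_snd

/-- Disintegrating `ρ` along `x` replaces `y` by its conditional mean. -/
theorem integral_residual_mul {f h : α → ℝ} (hf : MemLp f 2 P.ρX) (hh : MemLp h 2 P.ρX) :
    ∫ z, (f z.1 - z.2) * h z.1 ∂P.ρ = ∫ x, (f x - P.regression x) * h x ∂P.ρX := by
  have hh' := hh.comp_measurePreserving P.measurePreserving_fst
  have hint : Integrable (fun z : α × ℝ => (f z.1 - z.2) * h z.1) P.ρ :=
    (P.memLp_residual hf).integrable_mul hh'
  rw [← Measure.integral_condKernel hint]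
  refine integral_congr_ae ?_
  filter_upwards [(P.memLp_snd.integrable (by norm_num)).condKernel_ae] with x hx
  rw [integral_mul_const, integral_sub (integrable_const _) hx]
  simp [regression]

/-- The scalar factor of the stochastic gradient at `f`. -/
def gradCoeff (f : α → ℝ) (s : (α × ℝ) × V) : ℝ := (f s.1.1 - s.1.2) * P.φ s.2 s.1.1

variable {P} in
theorem BoundedBy.ae_abs_gradCoeff_le (hκ : 0 ≤ κ) (h : P.BoundedBy κ) (f : α → ℝ) :
    ∀ᵐ s ∂(P.ρ.prod P.μ), |P.gradCoeff f s| ≤ κ * |f s.1.1 - s.1.2| := by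
  have h1 : MeasurePreserving (fun s : (α × ℝ) × V => (s.2, s.1.1)) (P.ρ.prod P.μ)
      (P.μ.prod P.ρX) :=
    Measure.measurePreserving_swap.comp (P.measurePreserving_fst.prod (MeasurePreserving.id P.μ))
  filter_upwards [h1.quasiMeasurePreserving.ae (h.ae_prod_abs_le hκ)] with s hs
  rw [gradCoeff, abs_mul, mul_comm]
  exact mul_le_mul_of_nonneg_right hs (abs_nonneg _)

variable [SecondCountableTopology (Lp ℝ 2 P.ρX)]

variable {P} in
theorem BoundedBy.memLp_gradient (hκ : 0 ≤ κ) (h : P.BoundedBy κ) {f : α → ℝ} (hfm : Measurable f)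
    (hf : MemLp f 2 P.ρX) :
    MemLp (fun s => P.gradCoeff f s • P.feature s.2) 2 (P.ρ.prod P.μ) := by
  have h1 : MemLp (fun s : (α × ℝ) × V => f s.1.1 - s.1.2) 2 (P.ρ.prod P.μ) :=
    (P.memLp_residual hf).comp_measurePreserving MeasureTheory.measurePreserving_fst
  have hm : Measurable (P.gradCoeff f) :=
    ((hfm.comp (measurable_fst.comp measurable_fst)).sub (measurable_snd.comp measurable_fst)).mul
      (P.φ_measurable.comp (measurable_snd.prodMk (measurable_fst.comp measurable_fst)))
  refine h1.of_le_mul (c := κ ^ 2) ?_ ?_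
  · exact (hm.stronglyMeasurable.smul
      (P.stronglyMeasurable_feature.comp_measurable measurable_snd)).aestronglyMeasurable
  · filter_upwards [h.ae_abs_gradCoeff_le hκ f,
      Measure.quasiMeasurePreserving_snd.ae (h.ae_norm_feature_le hκ)] with s h2 h3
    rw [norm_smul, Real.norm_eq_abs, Real.norm_eq_abs]
    calc |P.gradCoeff f s| * ‖P.feature s.2‖ ≤ (κ * |f s.1.1 - s.1.2|) * κ :=
          mul_le_mul h2 h3 (norm_nonneg _) (by positivity)
      _ = κ ^ 2 * |f s.1.1 - s.1.2| := by ring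

variable {P} in
-- Unbiasedness of the doubly stochastic gradient: for fixed `v`, averaging over `z` gives `⟪φ_v, f
-- - f_ρ⟫ φ_v`, and averaging over `v` then gives `L_K`.
theorem integral_inner_gradient (hκ : 0 ≤ κ) (h : P.BoundedBy κ) {f : α → ℝ} (hfm : Measurable f)
    (hf : MemLp f 2 P.ρX) {fρ : Lp ℝ 2 P.ρX} (hρ : fρ =ᵐ[P.ρX] P.regression) (g : Lp ℝ 2 P.ρX) :
    ∫ s, ⟪P.gradCoeff f s • P.feature s.2, g⟫_ℝ ∂(P.ρ.prod P.μ)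
      = ⟪P.LK (toL2 P.ρX f - fρ), g⟫_ℝ := by
  rw [integral_prod_symm _ (((h.memLp_gradient hκ hfm hf).inner_const g).integrable (by norm_num)),
    inner_LK hκ h]
  refine integral_congr_ae ?_
  filter_upwards [P.ae_memLp_feature] with v hv
  simp only [inner_smul_left, RCLike.conj_to_real, gradCoeff]
  rw [integral_mul_const, P.integral_residual_mul hf hv, feature,
    inner_toL2 hv (toL2 P.ρX f - fρ)]
  congr 1
  refine integral_congr_ae ?_
  filter_upwards [Lp.coeFn_sub (toL2 P.ρX f) fρ, coeFn_toL2 hf, hρ] with x h1 h2 h3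
  rw [h1, Pi.sub_apply, h2, h3, mul_comm]

variable {P} in
-- Once the factor `φ_v(x)` is bounded by `κ`, the integrand is dominated by a function of `z` times
-- a function of `v`, and independence applies.
theorem lintegral_norm_sq_gradient_le (hκ : 0 ≤ κ) (h : P.BoundedBy κ) {f : α → ℝ}
    (hfm : Measurable f) (A : Lp ℝ 2 P.ρX →L[ℝ] Lp ℝ 2 P.ρX) :
    ∫⁻ s, ENNReal.ofReal (‖A (P.gradCoeff f s • P.feature s.2)‖ ^ 2) ∂(P.ρ.prod P.μ)
      ≤ ENNReal.ofReal (κ ^ 2) * P.risk f * ∫⁻ v, ENNReal.ofReal (‖A (P.feature v)‖ ^ 2) ∂P.μ := by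
  have h1 : Measurable fun z : α × ℝ => ENNReal.ofReal ((f z.1 - z.2) ^ 2) :=
    ((((hfm.comp measurable_fst).sub measurable_snd)).pow_const 2).ennreal_ofReal
  have h2 : Measurable fun v => ENNReal.ofReal (‖A (P.feature v)‖ ^ 2) :=
    ((A.continuous.comp_stronglyMeasurable
      P.stronglyMeasurable_feature).norm.measurable.pow_const 2).ennreal_ofReal
  rw [risk, ← lintegral_const_mul _ h1,
    ← lintegral_prod_mul (h1.const_mul _).aemeasurable h2.aemeasurable]
  refine lintegral_mono_ae ?_
  filter_upwards [h.ae_abs_gradCoeff_le hκ f] with s hs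
  rw [← ENNReal.ofReal_mul (sq_nonneg _), ← ENNReal.ofReal_mul (by positivity)]
  refine ENNReal.ofReal_le_ofReal ?_
  rw [map_smul, norm_smul, mul_pow, Real.norm_eq_abs, ← sq_abs (f _ - _), ← mul_pow κ]
  exact mul_le_mul_of_nonneg_right (pow_le_pow_left₀ (abs_nonneg _) hs 2) (sq_nonneg _)

variable {P} in
/-- Bias–variance bound for one stochastic gradient step from `f`. -/
theorem lintegral_norm_sq_step_le (hκ : 0 ≤ κ) (h : P.BoundedBy κ) {f : α → ℝ} (hfm : Measurable f)
    (hf : MemLp f 2 P.ρX) {fρ : Lp ℝ 2 P.ρX} (hρ : fρ =ᵐ[P.ρX] P.regression)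
    (A : Lp ℝ 2 P.ρX →L[ℝ] Lp ℝ 2 P.ρX) (c : Lp ℝ 2 P.ρX) (a : ℝ) :
    ∫⁻ s, ENNReal.ofReal (‖A (c - a • P.gradCoeff f s • P.feature s.2)‖ ^ 2) ∂(P.ρ.prod P.μ)
      ≤ ENNReal.ofReal (‖A (c - a • P.LK (toL2 P.ρX f - fρ))‖ ^ 2) +
        ENNReal.ofReal (κ ^ 2 * a ^ 2) * P.risk f *
          ∫⁻ v, ENNReal.ofReal (‖A (P.feature v)‖ ^ 2) ∂P.μ := by
  set m := P.LK (toL2 P.ρX f - fρ) with hm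
  set Y : (α × ℝ) × V → Lp ℝ 2 P.ρX := fun s => P.gradCoeff f s • P.feature s.2 with hY
  have hYL : MemLp Y 2 (P.ρ.prod P.μ) := h.memLp_gradient hκ hfm hf
  have hAY : MemLp (fun s => A (Y s)) 2 (P.ρ.prod P.μ) := A.comp_memLp' hYL
  have hsq : Integrable (fun s => ‖A (Y s)‖ ^ 2) (P.ρ.prod P.μ) :=
    hAY.integrable_norm_pow (by norm_num)
  have hin : Integrable (fun s => ⟪A c, A (Y s)⟫_ℝ) (P.ρ.prod P.μ) :=
    (hAY.const_inner (A c)).integrable (by norm_num)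
  have hmean : ∫ s, ⟪A c, A (Y s)⟫_ℝ ∂(P.ρ.prod P.μ) = ⟪A c, A m⟫_ℝ := by
    have h1 := integral_inner_gradient hκ h hfm hf hρ (A.adjoint (A c))
    rw [real_inner_comm (A m) (A c), ← ContinuousLinearMap.adjoint_inner_right, ← h1]
    refine integral_congr_ae (Filter.Eventually.of_forall fun s => ?_)
    simp only
    rw [real_inner_comm (A (Y s)) (A c), ← ContinuousLinearMap.adjoint_inner_right]
  have hexp : ∀ s, ‖A (c - a • Y s)‖ ^ 2
      = (‖A c‖ ^ 2 - 2 * a * ⟪A c, A (Y s)⟫_ℝ) + a ^ 2 * ‖A (Y s)‖ ^ 2 := by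
    intro s
    rw [map_sub, map_smul, norm_sub_sq_real, inner_smul_right, norm_smul, mul_pow,
      Real.norm_eq_abs, sq_abs]
    ring
  have hexpm : ‖A (c - a • m)‖ ^ 2
      = (‖A c‖ ^ 2 - 2 * a * ⟪A c, A m⟫_ℝ) + a ^ 2 * ‖A m‖ ^ 2 := by
    rw [map_sub, map_smul, norm_sub_sq_real, inner_smul_right, norm_smul, mul_pow,
      Real.norm_eq_abs, sq_abs]
    ring
  have hi1 : Integrable (fun s => ‖A c‖ ^ 2 - 2 * a * ⟪A c, A (Y s)⟫_ℝ) (P.ρ.prod P.μ) :=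
    (integrable_const _).sub (hin.const_mul _)
  have hint : Integrable (fun s => ‖A (c - a • Y s)‖ ^ 2) (P.ρ.prod P.μ) := by
    simp only [hexp]
    exact hi1.add (hsq.const_mul _)
  rw [← ofReal_integral_eq_lintegral_ofReal hint
    (Filter.Eventually.of_forall fun s => sq_nonneg _)]
  -- The exact variance has an additional `-a² ‖A m‖²`, which is dropped.
  have hle : ∫ s, ‖A (c - a • Y s)‖ ^ 2 ∂(P.ρ.prod P.μ)
      ≤ ‖A (c - a • m)‖ ^ 2 + a ^ 2 * ∫ s, ‖A (Y s)‖ ^ 2 ∂(P.ρ.prod P.μ) := by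
    simp only [hexp]
    rw [integral_add hi1 (hsq.const_mul _), integral_sub (integrable_const _) (hin.const_mul _),
      integral_const_mul, integral_const_mul, hmean, hexpm]
    simp only [integral_const, probReal_univ, one_smul]
    nlinarith [sq_nonneg (a * ‖A m‖)]
  refine (ENNReal.ofReal_le_ofReal hle).trans ?_
  rw [ENNReal.ofReal_add (sq_nonneg _)
    (mul_nonneg (sq_nonneg _) (integral_nonneg fun s => sq_nonneg _)),
    ENNReal.ofReal_mul (sq_nonneg a), ofReal_integral_eq_lintegral_ofReal hsq
    (Filter.Eventually.of_forall fun s => sq_nonneg _), mul_comm (κ ^ 2),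
    ENNReal.ofReal_mul (sq_nonneg a), mul_assoc, mul_assoc]
  refine add_le_add le_rfl (mul_le_mul_right ?_ _)
  rw [← mul_assoc]
  exact lintegral_norm_sq_gradient_le hκ h hfm A

omit [SecondCountableTopology (Lp ℝ 2 P.ρX)] in
variable {P} in
theorem risk_le {f : α → ℝ} (hfm : Measurable f) (hf : MemLp f 2 P.ρX) {fρ : Lp ℝ 2 P.ρX}
    (hρ : fρ =ᵐ[P.ρX] P.regression) (g : Lp ℝ 2 P.ρX) :
    P.risk f ≤ ENNReal.ofReal (3 / 2 * ‖toL2 P.ρX f - g‖ ^ 2) +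
      (ENNReal.ofReal (6 * ‖g - fρ‖ ^ 2) + 6 * P.risk P.regression) := by
  have hg := (Lp.stronglyMeasurable g).measurable
  have hfρ := (Lp.stronglyMeasurable fρ).measurable
  have key : ∀ {F : α → ℝ} (_ : Measurable F) (e : Lp ℝ 2 P.ρX) (_ : e =ᵐ[P.ρX] F) (b : ℝ)
      (_ : 0 ≤ b), ∫⁻ z, ENNReal.ofReal (b * F z.1 ^ 2) ∂P.ρ = ENNReal.ofReal (b * ‖e‖ ^ 2) := by
    intro F hF e he b hb
    have h1 : Measurable fun x => ENNReal.ofReal (b * F x ^ 2) :=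
      ((hF.pow_const 2).const_mul b).ennreal_ofReal
    rw [P.measurePreserving_fst.lintegral_comp h1, norm_sq_eq_integral, ← integral_const_mul,
      ofReal_integral_eq_lintegral_ofReal ((Lp.memLp e).integrable_sq.const_mul b)
        (Filter.Eventually.of_forall fun x => by positivity)]
    refine lintegral_congr_ae ?_
    filter_upwards [he] with x hx
    rw [hx]
  have e1 : (toL2 P.ρX f - g : Lp ℝ 2 P.ρX) =ᵐ[P.ρX] fun x => f x - g x := by
    filter_upwards [Lp.coeFn_sub (toL2 P.ρX f) g, coeFn_toL2 hf] with x h1 h2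
    rw [h1, Pi.sub_apply, h2]
  have e2 : (g - fρ : Lp ℝ 2 P.ρX) =ᵐ[P.ρX] fun x => g x - fρ x := Lp.coeFn_sub g fρ
  rw [← key (hfm.sub hg) _ e1 _ (by norm_num), ← key (hg.sub hfρ) _ e2 _ (by norm_num), risk, risk,
    ← lintegral_const_mul' _ _ (by norm_num : (6 : ℝ≥0∞) ≠ ∞)]
  have m1 : Measurable fun z : α × ℝ => ENNReal.ofReal (3 / 2 * (f - g) z.1 ^ 2) :=
    ((((hfm.sub hg).comp measurable_fst).pow_const 2).const_mul (3 / 2)).ennreal_ofReal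
  have m2 : Measurable fun z : α × ℝ => ENNReal.ofReal (6 * ((g : α → ℝ) - fρ) z.1 ^ 2) :=
    ((((hg.sub hfρ).comp measurable_fst).pow_const 2).const_mul 6).ennreal_ofReal
  rw [← lintegral_add_left m2, ← lintegral_add_left m1]
  refine lintegral_mono_ae ?_
  filter_upwards [P.measurePreserving_fst.quasiMeasurePreserving.ae hρ] with z hz
  rw [← hz, show (6 : ℝ≥0∞) = ENNReal.ofReal 6 by norm_num, ← ENNReal.ofReal_mul (by norm_num),
    ← ENNReal.ofReal_add (by positivity) (by positivity),
    ← ENNReal.ofReal_add (by positivity) (by positivity)]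
  refine ENNReal.ofReal_le_ofReal ?_
  simp only [Pi.sub_apply]
  -- The inequalities are `(p + q)² ≤ 3/2 p² + 3 q²` and then `q² ≤ 2 q₁² + 2 q₂²` for `q = q₁ +
  -- q₂`. The coefficient `3/2` is below `2`, which later lets weights of total `1/2` close the
  -- recursion.
  nlinarith [sq_nonneg ((f z.1 - g z.1) - 2 * (g z.1 - z.2)),
    sq_nonneg ((g z.1 - fρ z.1) - (fρ z.1 - z.2))]

end Problem

/-! ### The error recursion along the sample path. -/

namespace Problem

open BoundedPositive

variable {α V : Type*} [MeasurableSpace α] [MeasurableSpace V] (P : Problem α V) {κ : ℝ}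

theorem measurable_iterate (lam : ℝ) (η : ℕ → ℝ) (t : ℕ) :
    Measurable (Function.uncurry (P.iterate lam η t)) := by
  induction t with
  | zero => exact measurable_const
  | succ t ih =>
    have hw : Measurable fun p : (Fin (t + 1) → (α × ℝ) × V) × α => p.1 (Fin.last t) :=
      (measurable_pi_apply _).comp measurable_fst
    have hi : Measurable fun p : (Fin (t + 1) → (α × ℝ) × V) × α =>
        (Fin.init p.1 : Fin t → (α × ℝ) × V) :=
      measurable_pi_lambda _ fun i => (measurable_pi_apply (Fin.castSucc i)).comp measurable_fst
    have h1 : Measurable fun p : (Fin (t + 1) → (α × ℝ) × V) × α =>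
        P.iterate lam η t (Fin.init p.1) p.2 := ih.comp (hi.prodMk measurable_snd)
    have h2 : Measurable fun p : (Fin (t + 1) → (α × ℝ) × V) × α =>
        P.iterate lam η t (Fin.init p.1) (p.1 (Fin.last t)).1.1 :=
      ih.comp (hi.prodMk (measurable_fst.comp (measurable_fst.comp hw)))
    have h3 : Measurable fun p : (Fin (t + 1) → (α × ℝ) × V) × α =>
        P.φ (p.1 (Fin.last t)).2 (p.1 (Fin.last t)).1.1 :=
      P.φ_measurable.comp ((measurable_snd.comp hw).prodMk
        (measurable_fst.comp (measurable_fst.comp hw)))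
    have h4 : Measurable fun p : (Fin (t + 1) → (α × ℝ) × V) × α =>
        P.φ (p.1 (Fin.last t)).2 p.2 :=
      P.φ_measurable.comp ((measurable_snd.comp hw).prodMk measurable_snd)
    exact (h1.const_mul _).sub ((((h2.sub (measurable_snd.comp (measurable_fst.comp hw))).const_mul
      _).mul h3).mul h4)

theorem memLp_iterate (lam : ℝ) (η : ℕ → ℝ) {t : ℕ} {w : Fin t → (α × ℝ) × V}
    (hw : ∀ i, MemLp (P.φ (w i).2) 2 P.ρX) : MemLp (P.iterate lam η t w) 2 P.ρX := by
  induction t with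
  | zero => exact MemLp.zero
  | succ t ih =>
    have h1 := ih (w := Fin.init w) fun i => hw (Fin.castSucc i)
    exact (h1.const_mul _).sub ((hw (Fin.last t)).const_mul _)

/-- The law of the first `t` samples. -/
abbrev sampleLaw (t : ℕ) : Measure (Fin t → (α × ℝ) × V) :=
  Measure.pi fun _ : Fin t => P.ρ.prod P.μ

theorem ae_memLp_iterate (lam : ℝ) (η : ℕ → ℝ) (t : ℕ) :
    ∀ᵐ w ∂(P.sampleLaw t), MemLp (P.iterate lam η t w) 2 P.ρX := by
  have h : ∀ᵐ w ∂(P.sampleLaw t), ∀ i, MemLp (P.φ (w i).2) 2 P.ρX := by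
    refine ae_all_iff.2 fun i => ?_
    have h1 := (measurePreserving_eval (fun _ : Fin t => P.ρ.prod P.μ) i).quasiMeasurePreserving
    exact h1.ae (Measure.quasiMeasurePreserving_snd.ae P.ae_memLp_feature)
  filter_upwards [h] with w hw
  exact P.memLp_iterate lam η hw

theorem lintegral_sampleLaw_succ (t : ℕ) {G : (Fin (t + 1) → (α × ℝ) × V) → ℝ≥0∞}
    (hG : Measurable G) :
    ∫⁻ w, G w ∂(P.sampleLaw (t + 1))
      = ∫⁻ w, ∫⁻ s, G (Fin.snoc w s) ∂(P.ρ.prod P.μ) ∂(P.sampleLaw t) := by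
  have h := (measurePreserving_piFinSuccAbove (fun _ : Fin (t + 1) => P.ρ.prod P.μ)
    (Fin.last t)).symm
  have hm : Measurable fun q : ((α × ℝ) × V) × (Fin t → (α × ℝ) × V) =>
      G ((MeasurableEquiv.piFinSuccAbove (fun _ : Fin (t + 1) => (α × ℝ) × V)
        (Fin.last t)).symm q) := hG.comp (MeasurableEquiv.measurable _)
  rw [← h.lintegral_comp hG, lintegral_prod_symm' _ hm]
  refine lintegral_congr fun w => lintegral_congr fun s => ?_
  exact congrArg G (Fin.insertNth_last' s w)

theorem toL2_iterate_snoc (lam : ℝ) (η : ℕ → ℝ) {t : ℕ} {w : Fin t → (α × ℝ) × V}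
    (hw : MemLp (P.iterate lam η t w) 2 P.ρX) {s : (α × ℝ) × V}
    (hs : MemLp (P.φ s.2) 2 P.ρX) :
    toL2 P.ρX (P.iterate lam η (t + 1) (Fin.snoc w s)) =
      (1 - η (t + 1) * lam) • toL2 P.ρX (P.iterate lam η t w)
        - η (t + 1) • P.gradCoeff (P.iterate lam η t w) s • P.feature s.2 := by
  have h1 : P.iterate lam η (t + 1) (Fin.snoc w s) =
      (1 - η (t + 1) * lam) • P.iterate lam η t w
        - (η (t + 1) * P.gradCoeff (P.iterate lam η t w) s) • P.φ s.2 := by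
    funext u
    simp only [iterate, Fin.init_snoc, Fin.snoc_last, gradCoeff, Pi.sub_apply, Pi.smul_apply,
      smul_eq_mul]
    ring
  have h2 : MemLp ((1 - η (t + 1) * lam) • P.iterate lam η t w
      - (η (t + 1) * P.gradCoeff (P.iterate lam η t w) s) • P.φ s.2) 2 P.ρX :=
    (hw.const_smul _).sub (hs.const_smul _)
  rw [h1, feature, toL2_of_memLp h2, toL2_of_memLp hw, toL2_of_memLp hs, smul_smul]
  rfl

variable [SecondCountableTopology (Lp ℝ 2 P.ρX)]

/-- `𝔼 ‖A (f_{t+1} - h)‖²`. -/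
def errorAlong (lam : ℝ) (η : ℕ → ℝ) (h : Lp ℝ 2 P.ρX) (t : ℕ)
    (A : Lp ℝ 2 P.ρX →L[ℝ] Lp ℝ 2 P.ρX) : ℝ≥0∞ :=
  ∫⁻ w, ENNReal.ofReal (‖A (toL2 P.ρX (P.iterate lam η t w) - h)‖ ^ 2) ∂(P.sampleLaw t)

/-- `𝔼 𝓔(f_{t+1})`. -/
def expectedRisk (lam : ℝ) (η : ℕ → ℝ) (t : ℕ) : ℝ≥0∞ :=
  ∫⁻ w, P.risk (P.iterate lam η t w) ∂(P.sampleLaw t)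

theorem measurable_error (lam : ℝ) (η : ℕ → ℝ) (h : Lp ℝ 2 P.ρX) (t : ℕ)
    (A : Lp ℝ 2 P.ρX →L[ℝ] Lp ℝ 2 P.ρX) : Measurable fun w =>
      ENNReal.ofReal (‖A (toL2 P.ρX (P.iterate lam η t w) - h)‖ ^ 2) := by
  have h1 : StronglyMeasurable fun w => toL2 P.ρX (P.iterate lam η t w) :=
    stronglyMeasurable_toL2 (P.measurable_iterate lam η t)
  exact ((A.continuous.comp_stronglyMeasurable
    (h1.sub stronglyMeasurable_const)).norm.measurable.pow_const 2).ennreal_ofReal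

variable {P}

theorem expectedRisk_le (lam : ℝ) (η : ℕ → ℝ) {fρ : Lp ℝ 2 P.ρX} (hρ : fρ =ᵐ[P.ρX] P.regression)
    (g : Lp ℝ 2 P.ρX) (t : ℕ) :
    P.expectedRisk lam η t ≤ ENNReal.ofReal (3 / 2) * P.errorAlong lam η g t 1 +
      (ENNReal.ofReal (6 * ‖g - fρ‖ ^ 2) + 6 * P.risk P.regression) := by
  have h1 : P.expectedRisk lam η t ≤ ∫⁻ w, (ENNReal.ofReal (3 / 2) *
      ENNReal.ofReal (‖(1 : Lp ℝ 2 P.ρX →L[ℝ] Lp ℝ 2 P.ρX)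
        (toL2 P.ρX (P.iterate lam η t w) - g)‖ ^ 2) +
      (ENNReal.ofReal (6 * ‖g - fρ‖ ^ 2) + 6 * P.risk P.regression)) ∂(P.sampleLaw t) := by
    refine lintegral_mono_ae ?_
    filter_upwards [P.ae_memLp_iterate lam η t] with w hw
    rw [← ENNReal.ofReal_mul (by norm_num)]
    exact risk_le ((P.measurable_iterate lam η t).comp measurable_prodMk_left) hw hρ g
  refine h1.trans_eq ?_
  rw [lintegral_add_right _ measurable_const,
    lintegral_const_mul _ (P.measurable_error lam η g t 1), lintegral_const]
  simp [errorAlong]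

theorem errorAlong_succ_le (hκ : 0 ≤ κ) (hb : P.BoundedBy κ) {lam : ℝ} (η : ℕ → ℝ)
    {fρ h : Lp ℝ 2 P.ρX} (hρ : fρ =ᵐ[P.ρX] P.regression) (hh : P.LK h + lam • h = P.LK fρ) (t : ℕ)
    (A B : Lp ℝ 2 P.ρX →L[ℝ] Lp ℝ 2 P.ρX)
    (hB : ∀ x, B x = A (x - η (t + 1) • (P.LK x + lam • x))) :
    P.errorAlong lam η h (t + 1) A ≤ P.errorAlong lam η h t B +
      ENNReal.ofReal (κ ^ 2 * η (t + 1) ^ 2) *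
        (∫⁻ v, ENNReal.ofReal (‖A (P.feature v)‖ ^ 2) ∂P.μ) * P.expectedRisk lam η t := by
  set τ := ∫⁻ v, ENNReal.ofReal (‖A (P.feature v)‖ ^ 2) ∂P.μ with hτ
  have hmeas := P.measurable_error lam η h t B
  have h1 : P.errorAlong lam η h (t + 1) A ≤ ∫⁻ w,
      (ENNReal.ofReal (‖B (toL2 P.ρX (P.iterate lam η t w) - h)‖ ^ 2) +
        ENNReal.ofReal (κ ^ 2 * η (t + 1) ^ 2) * τ * P.risk (P.iterate lam η t w))
          ∂(P.sampleLaw t) := by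
    rw [errorAlong, lintegral_sampleLaw_succ P t (P.measurable_error lam η h (t + 1) A)]
    refine lintegral_mono_ae ?_
    filter_upwards [P.ae_memLp_iterate lam η t] with w hw
    have h2 : ∀ᵐ s ∂(P.ρ.prod P.μ), toL2 P.ρX (P.iterate lam η (t + 1) (Fin.snoc w s)) - h
        = ((1 - η (t + 1) * lam) • toL2 P.ρX (P.iterate lam η t w) - h)
          - η (t + 1) • P.gradCoeff (P.iterate lam η t w) s • P.feature s.2 := by
      filter_upwards [Measure.quasiMeasurePreserving_snd.ae P.ae_memLp_feature] with s hs
      rw [P.toL2_iterate_snoc lam η hw hs]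
      abel
    have h3 : ∫⁻ s, ENNReal.ofReal
        (‖A (toL2 P.ρX (P.iterate lam η (t + 1) (Fin.snoc w s)) - h)‖ ^ 2) ∂(P.ρ.prod P.μ) =
        ∫⁻ s, ENNReal.ofReal (‖A (((1 - η (t + 1) * lam) • toL2 P.ρX (P.iterate lam η t w) - h)
          - η (t + 1) • P.gradCoeff (P.iterate lam η t w) s • P.feature s.2)‖ ^ 2)
            ∂(P.ρ.prod P.μ) := by
      refine lintegral_congr_ae ?_
      filter_upwards [h2] with s hs
      rw [hs]
    rw [h3]
    have hm : Measurable (P.iterate lam η t w) :=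
      (P.measurable_iterate lam η t).comp measurable_prodMk_left
    refine (lintegral_norm_sq_step_le hκ hb hm hw hρ A _ _).trans_eq ?_
    rw [mul_right_comm, hB]
    -- The equation `L h + λ h = L f_ρ` makes `h` stationary for the mean step, so the error evolves
    -- linearly.
    have h4 : ((1 - η (t + 1) * lam) • toL2 P.ρX (P.iterate lam η t w) - h)
        - η (t + 1) • P.LK (toL2 P.ρX (P.iterate lam η t w) - fρ)
        = toL2 P.ρX (P.iterate lam η t w) - h - η (t + 1) •
          (P.LK (toL2 P.ρX (P.iterate lam η t w) - h)
            + lam • (toL2 P.ρX (P.iterate lam η t w) - h)) := by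
      rw [map_sub, map_sub, ← hh]
      module
    rw [h4]
  refine h1.trans ?_
  rw [lintegral_add_left hmeas]
  refine add_le_add le_rfl ?_
  -- Finiteness of `τ`, at most `(‖A‖ κ)²`, allows it to be pulled out of the integral without
  -- measurability of the risk along the iterates.
  by_cases hfin : τ = ∞
  · have h0 : ∀ᵐ v ∂P.μ, ENNReal.ofReal (‖A (P.feature v)‖ ^ 2)
        ≤ ENNReal.ofReal ((‖A‖ * κ) ^ 2) := by
      filter_upwards [hb.ae_norm_feature_le hκ] with v hv
      refine ENNReal.ofReal_le_ofReal (pow_le_pow_left₀ (norm_nonneg _) ?_ 2)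
      exact (A.le_opNorm _).trans (mul_le_mul_of_nonneg_left hv (norm_nonneg _))
    have h5 := lintegral_mono_ae h0
    rw [← hτ, hfin] at h5
    simp at h5
  · rw [lintegral_const_mul' _ _ (ENNReal.mul_ne_top ENNReal.ofReal_ne_top hfin)]
    rfl

/-- The unrolled error recursion. -/
theorem errorAlong_le_sum (hκ : 0 ≤ κ) (hb : P.BoundedBy κ) {lam : ℝ} (η : ℕ → ℝ)
    {fρ h : Lp ℝ 2 P.ρX} (hρ : fρ =ᵐ[P.ρX] P.regression) (hh : P.LK h + lam • h = P.LK fρ)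
    (N : ℕ) {n : ℕ} (hn : n ≤ N) :
    P.errorAlong lam η h n (stepProd P.LK lam (fun i => η (i + 1)) (Finset.Ico n N)) ≤
      ENNReal.ofReal (‖stepProd P.LK lam (fun i => η (i + 1)) (Finset.range N) h‖ ^ 2) +
      ∑ s ∈ Finset.range n, ENNReal.ofReal (κ ^ 2 * η (s + 1) ^ 2) *
        (∫⁻ v, ENNReal.ofReal (‖stepProd P.LK lam (fun i => η (i + 1)) (Finset.Ico (s + 1) N)
          (P.feature v)‖ ^ 2) ∂P.μ) * P.expectedRisk lam η s := by
  induction n with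
  | zero =>
    have h0 : ∀ w : Fin 0 → (α × ℝ) × V, toL2 P.ρX (P.iterate lam η 0 w) = 0 := fun w =>
      toL2_of_memLp (MemLp.zero : MemLp (fun _ : α => (0 : ℝ)) 2 P.ρX)
    rw [Finset.range_zero, Finset.sum_empty, add_zero, Finset.range_eq_Ico]
    simp only [errorAlong, h0, zero_sub, map_neg, norm_neg, lintegral_const, measure_univ, mul_one,
      le_refl]
  | succ n ih =>
    have h1 : insert n (Finset.Ico (n + 1) N) = Finset.Ico n N :=
      Finset.insert_Ico_add_one_left_eq_Ico (by omega)
    -- If `A` is the product of the steps still to come, then `B = A (I - η (L + λ))` is the product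
    -- one step earlier. The error is thus always measured through the remaining steps.
    refine (errorAlong_succ_le hκ hb η hρ hh n _ (stepProd P.LK lam (fun i => η (i + 1))
      (Finset.Ico n N)) fun x => ?_).trans ?_
    · rw [← h1, stepProd_insert_right _ _ (by simp)]
    · rw [Finset.sum_range_succ, ← add_assoc]
      exact add_le_add (ih (by omega)) le_rfl

end Problem

/-! ### Sums of weights for polynomial step sizes. -/

section StepSizes

/-- The factor multiplying the risk at step `s` in the bound for the variance after `n` steps. -/
def stepWeight (κ c γ lam : ℝ) (a : ℕ → ℝ) (s n : ℕ) : ℝ :=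
  κ ^ 2 * a s ^ 2 * (if s + 1 = n then κ ^ 2 else
    (∏ i ∈ Finset.Ico (s + 1) n, (1 - a i * lam)) ^ 2 *
      (c * (2 * ∑ i ∈ Finset.Ico (s + 1) n, a i) ^ (γ - 1)))

/-- The step sizes `η₁ t^{-θ}`, indexed from `0`. -/
def polyStep (η₁ θ : ℝ) (i : ℕ) : ℝ := η₁ * ((i + 1 : ℕ) : ℝ) ^ (-θ)

theorem prod_one_sub_le_exp {a : ℕ → ℝ} {lam : ℝ} {S : Finset ℕ} (h : ∀ i ∈ S, a i * lam ≤ 1) :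
    ∏ i ∈ S, (1 - a i * lam) ≤ Real.exp (-(lam * ∑ i ∈ S, a i)) := by
  rw [Finset.mul_sum, ← Finset.sum_neg_distrib, Real.exp_sum]
  refine Finset.prod_le_prod (fun i hi => by linarith [h i hi]) fun i _ => ?_
  rw [mul_comm lam]
  exact Real.one_sub_le_exp_neg _

theorem harmonic_half_le_log (n : ℕ) (hn : 1 ≤ n) :
    ∑ s ∈ Finset.range (n / 2), ((s + 1 : ℕ) : ℝ)⁻¹ ≤ Real.log (2 * n) := by
  have hn' : (1 : ℝ) ≤ n := by exact_mod_cast hn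
  rcases Nat.eq_zero_or_pos (n / 2) with h | h
  · rw [h, Finset.range_zero, Finset.sum_empty]
    exact Real.log_nonneg (by linarith)
  · have h1 : ∑ s ∈ Finset.range (n / 2), ((s + 1 : ℕ) : ℝ)⁻¹ = (harmonic (n / 2) : ℝ) := by
      simp [harmonic]
    have h2 : (0 : ℝ) < (n / 2 : ℕ) := by exact_mod_cast h
    have h3 : ((n / 2 : ℕ) : ℝ) ≤ n / 2 := Nat.cast_div_le
    have h4 : Real.log ((n / 2 : ℕ) : ℝ) ≤ Real.log (n / 2) := Real.log_le_log h2 h3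
    have h5 : Real.log (2 * n) = Real.log 4 + Real.log (n / 2) := by
      rw [← Real.log_mul (by norm_num) (by positivity)]
      congr 1
      ring
    -- As `e < 4`, the constant in `1 + log (n / 2)` is absorbed into `log (2 n)`.
    have h6 : (1 : ℝ) ≤ Real.log 4 := by
      rw [Real.le_log_iff_exp_le (by norm_num)]
      linarith [Real.exp_one_lt_d9]
    rw [h1]
    linarith [harmonic_le_one_add_log (n / 2)]

variable {θ γ : ℝ}

/-- For early `s` the gap `m - s` is at least `(m + 1) / 2`, so its power is comparable to that of
`m + 1`. The rest reduces to a harmonic sum, at the price `(m + 1)^((1-2θ)₊)`. -/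
theorem sum_far_le (hγ1 : γ ≤ 1) (m : ℕ) :
    ∑ s ∈ Finset.range m with 2 * (s + 1) ≤ m + 1,
        ((s + 1 : ℕ) : ℝ) ^ (-(2 * θ)) * ((m - s : ℕ) : ℝ) ^ (γ - 1)
      ≤ 2 ^ (1 - γ) * ((m + 1 : ℕ) : ℝ) ^ (γ - 1 + max (1 - 2 * θ) 0)
        * Real.log (2 * (m + 1 : ℕ)) := by
  have hn : (0 : ℝ) < (m + 1 : ℕ) := by positivity
  have h1 : ∀ s ∈ (Finset.range m).filter (fun s => 2 * (s + 1) ≤ m + 1),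
      ((s + 1 : ℕ) : ℝ) ^ (-(2 * θ)) * ((m - s : ℕ) : ℝ) ^ (γ - 1)
      ≤ 2 ^ (1 - γ) * ((m + 1 : ℕ) : ℝ) ^ (γ - 1 + max (1 - 2 * θ) 0)
        * ((s + 1 : ℕ) : ℝ)⁻¹ := by
    intro s hs
    rw [Finset.mem_filter, Finset.mem_range] at hs
    have ht : (0 : ℝ) < (s + 1 : ℕ) := by positivity
    have ht1 : (1 : ℝ) ≤ (s + 1 : ℕ) := by exact_mod_cast Nat.succ_le_succ (Nat.zero_le s)
    have htn : ((s + 1 : ℕ) : ℝ) ≤ (m + 1 : ℕ) := by exact_mod_cast (by omega : s + 1 ≤ m + 1)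
    have h2 : ((m + 1 : ℕ) : ℝ) / 2 ≤ (m - s : ℕ) := by
      rw [div_le_iff₀ two_pos]
      exact_mod_cast (by omega : m + 1 ≤ (m - s) * 2)
    have h3 : ((m - s : ℕ) : ℝ) ^ (γ - 1) ≤ 2 ^ (1 - γ) * ((m + 1 : ℕ) : ℝ) ^ (γ - 1) := by
      refine (Real.rpow_le_rpow_of_nonpos (by positivity) h2 (by linarith)).trans_eq ?_
      rw [Real.div_rpow hn.le two_pos.le, ← neg_sub γ 1, Real.rpow_neg two_pos.le, div_eq_inv_mul]
    have h4 : ((s + 1 : ℕ) : ℝ) ^ (-(2 * θ))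
        ≤ ((m + 1 : ℕ) : ℝ) ^ max (1 - 2 * θ) 0 * ((s + 1 : ℕ) : ℝ)⁻¹ := by
      rw [show -(2 * θ) = (1 - 2 * θ) - 1 by ring, Real.rpow_sub_one ht.ne', div_eq_mul_inv]
      refine mul_le_mul_of_nonneg_right ?_ (by positivity)
      exact (Real.rpow_le_rpow_of_exponent_le ht1 (le_max_left _ _)).trans
        (Real.rpow_le_rpow ht.le htn (le_max_right _ _))
    calc _ ≤ (((m + 1 : ℕ) : ℝ) ^ max (1 - 2 * θ) 0 * ((s + 1 : ℕ) : ℝ)⁻¹) *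
          (2 ^ (1 - γ) * ((m + 1 : ℕ) : ℝ) ^ (γ - 1)) := by gcongr
      _ = _ := by rw [Real.rpow_add hn]; ring
  refine (Finset.sum_le_sum h1).trans ?_
  rw [← Finset.mul_sum]
  refine mul_le_mul_of_nonneg_left ?_ (by positivity)
  refine le_trans (le_of_eq ?_) (harmonic_half_le_log (m + 1) (by omega))
  refine Finset.sum_congr ?_ fun _ _ => rfl
  ext s
  simp only [Finset.mem_filter, Finset.mem_range]
  omega

/-- The roles are exchanged for late `s`: `s + 1` is comparable to `m + 1`, and the harmonic sum
runs over the gap `m - s`. -/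
theorem sum_near_le (hθ : 0 ≤ θ) (hγ : 0 ≤ γ) (m : ℕ) :
    ∑ s ∈ Finset.range m with ¬ 2 * (s + 1) ≤ m + 1,
        ((s + 1 : ℕ) : ℝ) ^ (-(2 * θ)) * ((m - s : ℕ) : ℝ) ^ (γ - 1)
      ≤ 2 ^ (2 * θ) * ((m + 1 : ℕ) : ℝ) ^ (γ - 2 * θ) * Real.log (2 * (m + 1 : ℕ)) := by
  have hn : (0 : ℝ) < (m + 1 : ℕ) := by positivity
  set F := (Finset.range m).filter fun s => ¬ 2 * (s + 1) ≤ m + 1 with hF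
  have h1 : ∀ s ∈ F, ((s + 1 : ℕ) : ℝ) ^ (-(2 * θ)) * ((m - s : ℕ) : ℝ) ^ (γ - 1)
      ≤ 2 ^ (2 * θ) * ((m + 1 : ℕ) : ℝ) ^ (γ - 2 * θ) * ((m - 1 - s + 1 : ℕ) : ℝ)⁻¹ := by
    intro s hs
    rw [hF, Finset.mem_filter, Finset.mem_range] at hs
    have hms : m - 1 - s + 1 = m - s := by omega
    have hj : (0 : ℝ) < (m - s : ℕ) := by exact_mod_cast (by omega : 0 < m - s)
    have hjn : ((m - s : ℕ) : ℝ) ≤ (m + 1 : ℕ) := by exact_mod_cast (by omega : m - s ≤ m + 1)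
    have h2 : ((m + 1 : ℕ) : ℝ) / 2 ≤ (s + 1 : ℕ) := by
      rw [div_le_iff₀ two_pos]
      exact_mod_cast (by omega : m + 1 ≤ (s + 1) * 2)
    have h3 : ((s + 1 : ℕ) : ℝ) ^ (-(2 * θ)) ≤ 2 ^ (2 * θ) * ((m + 1 : ℕ) : ℝ) ^ (-(2 * θ)) := by
      refine (Real.rpow_le_rpow_of_nonpos (by positivity) h2 (by linarith)).trans_eq ?_
      rw [Real.div_rpow hn.le two_pos.le, Real.rpow_neg two_pos.le, div_eq_mul_inv, inv_inv,
        mul_comm]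
    have h4 : ((m - s : ℕ) : ℝ) ^ (γ - 1) ≤ ((m + 1 : ℕ) : ℝ) ^ γ * ((m - s : ℕ) : ℝ)⁻¹ := by
      rw [Real.rpow_sub_one hj.ne', div_eq_mul_inv]
      exact mul_le_mul_of_nonneg_right (Real.rpow_le_rpow hj.le hjn hγ) (by positivity)
    rw [hms]
    calc _ ≤ (2 ^ (2 * θ) * ((m + 1 : ℕ) : ℝ) ^ (-(2 * θ))) *
          (((m + 1 : ℕ) : ℝ) ^ γ * ((m - s : ℕ) : ℝ)⁻¹) := by gcongr
      _ = _ := by rw [sub_eq_add_neg, Real.rpow_add hn]; ring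
  refine (Finset.sum_le_sum h1).trans ?_
  rw [← Finset.mul_sum]
  refine mul_le_mul_of_nonneg_left ?_ (by positivity)
  refine le_trans ?_ (harmonic_half_le_log (m + 1) (by omega))
  have hinj : Set.InjOn (fun s => m - 1 - s) F := by
    intro s hs t ht hst
    simp only [hF, Finset.coe_filter, Finset.mem_range, Set.mem_ofPred_eq] at hs ht hst
    omega
  rw [← Finset.sum_image (f := fun j : ℕ => ((j + 1 : ℕ) : ℝ)⁻¹) hinj]
  refine Finset.sum_le_sum_of_subset_of_nonneg ?_ fun _ _ _ => by positivity
  intro j hj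
  simp only [hF, Finset.mem_image, Finset.mem_filter, Finset.mem_range] at hj ⊢
  omega

variable {κ c lam η₁ : ℝ}

theorem polyStep_pos (hη : 0 < η₁) (i : ℕ) : 0 < polyStep η₁ θ i := by
  unfold polyStep
  positivity

theorem polyStep_le (hη : 0 < η₁) (hθ : 0 ≤ θ) (i : ℕ) : polyStep η₁ θ i ≤ η₁ := by
  refine mul_le_of_le_one_right hη.le (Real.rpow_le_one_of_one_le_of_nonpos ?_ (by linarith))
  exact_mod_cast Nat.succ_le_succ (Nat.zero_le i)

theorem le_sum_polyStep (hη : 0 < η₁) (hθ : 0 ≤ θ) (k n : ℕ) :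
    ((n - k : ℕ) : ℝ) * (η₁ * (n : ℝ) ^ (-θ)) ≤ ∑ i ∈ Finset.Ico k n, polyStep η₁ θ i := by
  have h := Finset.card_nsmul_le_sum (Finset.Ico k n) (polyStep η₁ θ) (η₁ * (n : ℝ) ^ (-θ)) ?_
  · rwa [Nat.card_Ico, nsmul_eq_mul] at h
  · intro i hi
    rw [Finset.mem_Ico] at hi
    refine mul_le_mul_of_nonneg_left ?_ hη.le
    refine Real.rpow_le_rpow_of_nonpos (by positivity) ?_ (by linarith)
    exact_mod_cast hi.2

/-- The `m - s` later steps are all at least the last one, `η₁ (m + 1)^(-θ)`. This lower bound on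
their sum serves both the exponential and the power `γ - 1 ≤ 0`. -/
theorem stepWeight_le (hη : 0 < η₁) (hθ : 0 ≤ θ) (hγ1 : γ ≤ 1) (hc : 0 < c) (hlam : 0 ≤ lam)
    (ha : ∀ i, polyStep η₁ θ i * lam ≤ 1) {s m : ℕ} (hs : s < m) :
    stepWeight κ c γ lam (polyStep η₁ θ) s (m + 1) ≤
      κ ^ 2 * c * 2 ^ (γ - 1) * η₁ ^ (1 + γ) * ((m + 1 : ℕ) : ℝ) ^ (θ * (1 - γ)) *
        (((s + 1 : ℕ) : ℝ) ^ (-(2 * θ)) * ((m - s : ℕ) : ℝ) ^ (γ - 1)) *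
        Real.exp (-(2 * lam * (((m - s : ℕ) : ℝ) * (η₁ * ((m + 1 : ℕ) : ℝ) ^ (-θ))))) := by
  have hn : (0 : ℝ) < (m + 1 : ℕ) := by positivity
  have hj : (0 : ℝ) < (m - s : ℕ) := by exact_mod_cast (by omega : 0 < m - s)
  have hσ := le_sum_polyStep hη hθ (s + 1) (m + 1)
  rw [show m + 1 - (s + 1) = m - s by omega] at hσ
  set σ := ∑ i ∈ Finset.Ico (s + 1) (m + 1), polyStep η₁ θ i
  set b := ((m - s : ℕ) : ℝ) * (η₁ * ((m + 1 : ℕ) : ℝ) ^ (-θ)) with hb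
  have hb0 : 0 < b := by positivity
  have h0 : 0 ≤ ∏ i ∈ Finset.Ico (s + 1) (m + 1), (1 - polyStep η₁ θ i * lam) :=
    Finset.prod_nonneg fun i _ => by linarith [ha i]
  have h1 : (∏ i ∈ Finset.Ico (s + 1) (m + 1), (1 - polyStep η₁ θ i * lam)) ^ 2
      ≤ Real.exp (-(2 * lam * b)) := by
    refine (pow_le_pow_left₀ h0 (prod_one_sub_le_exp fun i _ => ha i) 2).trans ?_
    rw [← Real.exp_nat_mul, Real.exp_le_exp]
    push_cast
    nlinarith [mul_le_mul_of_nonneg_left hσ hlam]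
  have h2 : (2 * σ) ^ (γ - 1) ≤ (2 * b) ^ (γ - 1) :=
    Real.rpow_le_rpow_of_nonpos (by positivity) (by linarith) (by linarith)
  have h3 : (2 * b) ^ (γ - 1) = 2 ^ (γ - 1) * ((m - s : ℕ) : ℝ) ^ (γ - 1) *
      (η₁ ^ (γ - 1) * ((m + 1 : ℕ) : ℝ) ^ (θ * (1 - γ))) := by
    rw [hb, Real.mul_rpow two_pos.le (by positivity), Real.mul_rpow hj.le (by positivity),
      Real.mul_rpow hη.le (by positivity), ← Real.rpow_mul hn.le,
      show -θ * (γ - 1) = θ * (1 - γ) by ring]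
    ring
  have h4 : polyStep η₁ θ s ^ 2 = η₁ ^ 2 * ((s + 1 : ℕ) : ℝ) ^ (-(2 * θ)) := by
    rw [polyStep, mul_pow, ← Real.rpow_mul_natCast (by positivity)]
    congr 2
    push_cast
    ring
  have h5 : η₁ ^ (1 + γ) = η₁ ^ 2 * η₁ ^ (γ - 1) := by
    rw [← Real.rpow_natCast, ← Real.rpow_add hη]
    congr 1
    push_cast
    ring
  rw [stepWeight, if_neg (by omega), h4]
  calc _ ≤ κ ^ 2 * (η₁ ^ 2 * ((s + 1 : ℕ) : ℝ) ^ (-(2 * θ))) *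
        (Real.exp (-(2 * lam * b)) * (c * (2 * b) ^ (γ - 1))) := by
          have hσ0 : 0 < σ := hb0.trans_le hσ
          refine mul_le_mul_of_nonneg_left ?_ (by positivity)
          exact mul_le_mul h1 (mul_le_mul_of_nonneg_left h2 hc.le) (by positivity)
            (Real.exp_pos _).le
    _ = _ := by rw [h3, h5]; ring

theorem stepWeight_last (m : ℕ) :
    stepWeight κ c γ lam (polyStep η₁ θ) m (m + 1)
      = κ ^ 4 * η₁ ^ 2 * ((m + 1 : ℕ) : ℝ) ^ (-(2 * θ)) := by
  rw [stepWeight, if_pos rfl, polyStep, mul_pow, ← Real.rpow_mul_natCast (by positivity),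
    show -θ * (2 : ℕ) = -(2 * θ) by push_cast; ring]
  ring

theorem far_exponent : θ * (1 - γ) + (γ - 1 + max (1 - 2 * θ) 0)
    = γ - θ * (γ + 1) + max (2 * θ - 1) 0 := by
  rcases le_total (2 * θ) 1 with h | h
  · rw [max_eq_left (by linarith), max_eq_right (by linarith)]; ring
  · rw [max_eq_right (by linarith), max_eq_left (by linarith)]; ring

/-- The exponential is kept only on the early half, where the gap is at least `(m + 1) / 2`; the
last weight stands apart. -/
theorem sum_stepWeight_le (hη : 0 < η₁) (hθ : 0 ≤ θ) (hγ : 0 ≤ γ) (hγ1 : γ ≤ 1) (hc : 0 < c)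
    (hlam : 0 ≤ lam) (ha : ∀ i, polyStep η₁ θ i * lam ≤ 1) (m : ℕ) :
    ∑ s ∈ Finset.range (m + 1), stepWeight κ c γ lam (polyStep η₁ θ) s (m + 1) ≤
      κ ^ 2 * c * η₁ ^ (1 + γ) * Real.log (2 * (m + 1 : ℕ)) *
        (((m + 1 : ℕ) : ℝ) ^ (γ - θ * (γ + 1) + max (2 * θ - 1) 0) *
            Real.exp (-(lam * (η₁ * ((m + 1 : ℕ) : ℝ) ^ (1 - θ)))) +
          2 ^ (2 * θ) * ((m + 1 : ℕ) : ℝ) ^ (γ - θ * (γ + 1))) +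
      κ ^ 4 * η₁ ^ 2 * ((m + 1 : ℕ) : ℝ) ^ (-(2 * θ)) := by
  have hn : (0 : ℝ) < (m + 1 : ℕ) := by positivity
  have hlog : 0 ≤ Real.log (2 * (m + 1 : ℕ)) := Real.log_nonneg (by push_cast; linarith)
  rw [Finset.sum_range_succ, stepWeight_last,
    ← Finset.sum_filter_add_sum_filter_not (Finset.range m) fun s => 2 * (s + 1) ≤ m + 1, mul_add]
  set K := κ ^ 2 * c * 2 ^ (γ - 1) * η₁ ^ (1 + γ) * ((m + 1 : ℕ) : ℝ) ^ (θ * (1 - γ)) with hK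
  have hK0 : 0 ≤ K := by positivity
  have h2 : (2 : ℝ) ^ (γ - 1) * 2 ^ (1 - γ) = 1 := by
    rw [← Real.rpow_add two_pos]; simp
  have h3 : (2 : ℝ) ^ (γ - 1) ≤ 1 :=
    Real.rpow_le_one_of_one_le_of_nonpos one_le_two (by linarith)
  refine add_le_add (add_le_add ?_ ?_) le_rfl
  · have h1 : ∀ s ∈ (Finset.range m).filter (fun s => 2 * (s + 1) ≤ m + 1),
        stepWeight κ c γ lam (polyStep η₁ θ) s (m + 1) ≤
        K * Real.exp (-(lam * (η₁ * ((m + 1 : ℕ) : ℝ) ^ (1 - θ)))) *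
          (((s + 1 : ℕ) : ℝ) ^ (-(2 * θ)) * ((m - s : ℕ) : ℝ) ^ (γ - 1)) := by
      intro s hs
      rw [Finset.mem_filter, Finset.mem_range] at hs
      refine (stepWeight_le hη hθ hγ1 hc hlam ha hs.1).trans ?_
      rw [← hK, mul_right_comm K]
      refine mul_le_mul_of_nonneg_right (mul_le_mul_of_nonneg_left ?_ hK0) (by positivity)
      rw [Real.exp_le_exp, neg_le_neg_iff, mul_comm 2 lam, mul_assoc]
      refine mul_le_mul_of_nonneg_left ?_ hlam
      rw [sub_eq_add_neg, Real.rpow_add hn, Real.rpow_one]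
      have h4 : ((m + 1 : ℕ) : ℝ) ≤ 2 * (m - s : ℕ) := by
        exact_mod_cast (by omega : m + 1 ≤ 2 * (m - s))
      calc η₁ * (((m + 1 : ℕ) : ℝ) * ((m + 1 : ℕ) : ℝ) ^ (-θ))
          = ((m + 1 : ℕ) : ℝ) * (η₁ * ((m + 1 : ℕ) : ℝ) ^ (-θ)) := by ring
        _ ≤ (2 * (m - s : ℕ)) * (η₁ * ((m + 1 : ℕ) : ℝ) ^ (-θ)) := by gcongr
        _ = _ := by ring
    refine (Finset.sum_le_sum h1).trans ?_
    rw [← Finset.mul_sum]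
    refine (mul_le_mul_of_nonneg_left (sum_far_le hγ1 m) (by positivity)).trans_eq ?_
    rw [hK, ← far_exponent, Real.rpow_add hn (θ * (1 - γ))]
    linear_combination (κ ^ 2 * c * η₁ ^ (1 + γ) * ((m + 1 : ℕ) : ℝ) ^ (θ * (1 - γ)) *
      Real.exp (-(lam * (η₁ * ((m + 1 : ℕ) : ℝ) ^ (1 - θ)))) *
      ((m + 1 : ℕ) : ℝ) ^ (γ - 1 + max (1 - 2 * θ) 0) * Real.log (2 * (m + 1 : ℕ))) * h2
  · have h1 : ∀ s ∈ (Finset.range m).filter (fun s => ¬ 2 * (s + 1) ≤ m + 1),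
        stepWeight κ c γ lam (polyStep η₁ θ) s (m + 1) ≤
        K * (((s + 1 : ℕ) : ℝ) ^ (-(2 * θ)) * ((m - s : ℕ) : ℝ) ^ (γ - 1)) := by
      intro s hs
      rw [Finset.mem_filter, Finset.mem_range] at hs
      refine (stepWeight_le hη hθ hγ1 hc hlam ha hs.1).trans ?_
      refine mul_le_of_le_one_right (by positivity) (Real.exp_le_one_iff.2 ?_)
      rw [neg_nonpos]
      positivity
    refine (Finset.sum_le_sum h1).trans ?_
    rw [← Finset.mul_sum]
    refine (mul_le_mul_of_nonneg_left (sum_near_le hθ hγ m) hK0).trans ?_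
    have h5 : ((m + 1 : ℕ) : ℝ) ^ (γ - θ * (γ + 1))
        = ((m + 1 : ℕ) : ℝ) ^ (θ * (1 - γ)) * ((m + 1 : ℕ) : ℝ) ^ (γ - 2 * θ) := by
      rw [← Real.rpow_add hn]
      congr 1
      ring
    rw [hK, h5]
    calc _ = 2 ^ (γ - 1) * (κ ^ 2 * c * η₁ ^ (1 + γ) * Real.log (2 * (m + 1 : ℕ)) * (2 ^ (2 * θ) *
          (((m + 1 : ℕ) : ℝ) ^ (θ * (1 - γ)) * ((m + 1 : ℕ) : ℝ) ^ (γ - 2 * θ)))) := by ring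
      _ ≤ _ := mul_le_of_le_one_left (by positivity) h3

theorem step_le_one (hη : 0 < η₁) (hκ : 1 ≤ κ) (hc : 0 < c) {M : ℝ}
    (hM : Real.log 2 ≤ M)
    (hηM : η₁ ≤ 1 / (4 * κ ^ 2 * ((2 : ℝ) ^ (2 * θ) * c + κ ^ 2) * M)) :
    4 * κ ^ 2 * ((2 : ℝ) ^ (2 * θ) * c + κ ^ 2) * M * η₁ ≤ 1 ∧ η₁ * (κ ^ 2 + 1) < 1 ∧ η₁ ≤ 1 := by
  have hl := Real.log_two_gt_d9
  have hM0 : 0 < M := by linarith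
  have hκ2 : 1 ≤ κ ^ 2 := one_le_pow₀ hκ
  have h1 : 0 < (2 : ℝ) ^ (2 * θ) * c := by positivity
  have h2 : 4 * κ ^ 2 * ((2 : ℝ) ^ (2 * θ) * c + κ ^ 2) * M * η₁ ≤ 1 := by
    rw [le_div_iff₀ (by positivity)] at hηM
    linarith
  have hD : 1 / 2 < ((2 : ℝ) ^ (2 * θ) * c + κ ^ 2) * M := by nlinarith
  have h3 := mul_lt_mul_of_pos_left hD (by positivity : 0 < 4 * κ ^ 2 * η₁)
  have h4 : η₁ * (κ ^ 2 + 1) < 1 := by nlinarith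
  exact ⟨h2, h4, by nlinarith⟩

theorem sum_stepWeight_le_half (hη : 0 < η₁) (hθ : 0 ≤ θ) (hγ : 0 ≤ γ) (hγ1 : γ ≤ 1) (hc : 0 < c)
    (hκ : 1 ≤ κ) (hlam : 0 ≤ lam) (ha : ∀ i, polyStep η₁ θ i * lam ≤ 1) {M : ℝ}
    (hM : Real.log 2 ≤ M)
    (hηM : η₁ ≤ 1 / (4 * κ ^ 2 * ((2 : ℝ) ^ (2 * θ) * c + κ ^ 2) * M)) (m : ℕ)
    (hm : ((m + 1 : ℕ) : ℝ) ^ (γ - θ * (γ + 1) + max (2 * θ - 1) 0)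
      * Real.log (2 * (m + 1 : ℕ)) ≤ M) :
    ∑ s ∈ Finset.range (m + 1), stepWeight κ c γ lam (polyStep η₁ θ) s (m + 1) ≤ 1 / 2 := by
  obtain ⟨h1, -, h2⟩ := step_le_one hη hκ hc hM hηM
  have hl := Real.log_two_gt_d9
  have hM0 : 0 < M := by linarith
  have hn : (0 : ℝ) < (m + 1 : ℕ) := by positivity
  have hn1 : (1 : ℝ) ≤ (m + 1 : ℕ) := by exact_mod_cast Nat.succ_le_succ (Nat.zero_le m)
  have hlog : 0 ≤ Real.log (2 * (m + 1 : ℕ)) := Real.log_nonneg (by linarith)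
  have h3 : η₁ ^ (1 + γ) ≤ η₁ := by
    simpa using Real.rpow_le_rpow_of_exponent_ge hη h2 (by linarith : (1 : ℝ) ≤ 1 + γ)
  have h4 : η₁ ^ 2 ≤ η₁ := by nlinarith
  have h5 : ((m + 1 : ℕ) : ℝ) ^ (-(2 * θ)) ≤ 1 :=
    Real.rpow_le_one_of_one_le_of_nonpos hn1 (by linarith)
  have h6 : (1 : ℝ) ≤ 2 ^ (2 * θ) := Real.one_le_rpow one_le_two (by linarith)
  have h7 : Real.exp (-(lam * (η₁ * ((m + 1 : ℕ) : ℝ) ^ (1 - θ)))) ≤ 1 := by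
    rw [Real.exp_le_one_iff, neg_nonpos]
    positivity
  have h8 : ((m + 1 : ℕ) : ℝ) ^ (γ - θ * (γ + 1))
      ≤ ((m + 1 : ℕ) : ℝ) ^ (γ - θ * (γ + 1) + max (2 * θ - 1) 0) :=
    Real.rpow_le_rpow_of_exponent_le hn1 (by linarith [le_max_right (2 * θ - 1) 0])
  refine (sum_stepWeight_le hη hθ hγ hγ1 hc hlam ha m).trans ?_
  set p := ((m + 1 : ℕ) : ℝ) ^ (γ - θ * (γ + 1) + max (2 * θ - 1) 0) with hp
  have hp0 : 0 < p := by positivity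
  have h9 : p * Real.exp (-(lam * (η₁ * ((m + 1 : ℕ) : ℝ) ^ (1 - θ)))) +
      2 ^ (2 * θ) * ((m + 1 : ℕ) : ℝ) ^ (γ - θ * (γ + 1)) ≤ 2 * 2 ^ (2 * θ) * p := by
    have := mul_le_mul_of_nonneg_left h7 hp0.le
    have := mul_le_mul_of_nonneg_left h8 (by positivity : (0 : ℝ) ≤ 2 ^ (2 * θ))
    nlinarith
  -- The last weight is absorbed through `1 ≤ 2 M`, from `M ≥ log 2 > 1/2`.
  calc _ ≤ κ ^ 2 * c * η₁ * Real.log (2 * (m + 1 : ℕ)) * (2 * 2 ^ (2 * θ) * p) +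
        κ ^ 4 * η₁ * 1 := by gcongr
    _ = 2 * (κ ^ 2 * (2 ^ (2 * θ) * c) * η₁) * (p * Real.log (2 * (m + 1 : ℕ))) +
        κ ^ 4 * η₁ * 1 := by ring
    _ ≤ 2 * (κ ^ 2 * (2 ^ (2 * θ) * c) * η₁) * M + κ ^ 4 * η₁ * (2 * M) := by
        gcongr
        linarith
    _ = (4 * κ ^ 2 * ((2 : ℝ) ^ (2 * θ) * c + κ ^ 2) * M * η₁) / 2 := by ring
    _ ≤ 1 / 2 := by linarith

/-- The exponent is `5 = 3 + 2`: the early half grows at most like `x³`, logarithm included, and a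
factor `x⁻²` is to be left over. -/
theorem exists_pow_mul_exp_le {η ε : ℝ} (hη : 0 < η) (hε : 0 < ε) :
    ∃ C : ℝ, 0 < C ∧ ∀ x : ℝ, 1 ≤ x → x ^ (5 : ℝ) * Real.exp (-(η * x ^ ε)) ≤ C := by
  obtain ⟨k, hk⟩ := exists_nat_ge (5 / ε)
  refine ⟨k.factorial / η ^ k, by positivity, fun x hx => ?_⟩
  have hx0 : 0 < x := by linarith
  have h1 : x ^ (5 : ℝ) ≤ (x ^ ε) ^ k := by
    rw [← Real.rpow_mul_natCast hx0.le]
    refine Real.rpow_le_rpow_of_exponent_le hx ?_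
    rw [div_le_iff₀ hε] at hk
    linarith
  have h2 := Real.pow_div_factorial_le_exp (η * x ^ ε) (by positivity) k
  rw [Real.exp_neg, ← div_eq_mul_inv, div_le_div_iff₀ (Real.exp_pos _) (by positivity)]
  rw [div_le_iff₀ (by positivity), mul_pow] at h2
  calc x ^ (5 : ℝ) * η ^ k ≤ (x ^ ε) ^ k * η ^ k := by gcongr
    _ = η ^ k * (x ^ ε) ^ k := by ring
    _ ≤ Real.exp (η * x ^ ε) * k.factorial := h2
    _ = _ := by ring

/-- The sum of the weights decays at the rate of the variance. -/
theorem exists_sum_stepWeight_le (hη : 0 < η₁) (hθ : 0 ≤ θ) (hθ1 : θ ≤ 1) (hγ : 0 ≤ γ)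
    (hγ1 : γ ≤ 1) (hc : 0 < c) {ε : ℝ} (hε : 0 < ε) (κ : ℝ) :
    ∃ C : ℝ, 0 < C ∧ ∀ m : ℕ,
      (∀ i, polyStep η₁ θ i * ((m + 1 : ℕ) : ℝ) ^ (θ - 1 + ε) ≤ 1) →
      ∑ s ∈ Finset.range (m + 1), stepWeight κ c γ (((m + 1 : ℕ) : ℝ) ^ (θ - 1 + ε))
        (polyStep η₁ θ) s (m + 1) ≤
      C * (((m + 1 : ℕ) : ℝ) ^ (-2 : ℝ) +
        ((m + 1 : ℕ) : ℝ) ^ (γ - θ * (γ + 1)) * Real.log (2 * (m + 1 : ℕ))) := by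
  obtain ⟨C₀, hC₀, h0⟩ := exists_pow_mul_exp_le hη hε
  refine ⟨2 * (κ ^ 2 * c * η₁ ^ (1 + γ) * C₀) + κ ^ 2 * c * η₁ ^ (1 + γ) * 2 ^ (2 * θ) +
    2 * (κ ^ 4 * η₁ ^ 2) + 1, by positivity, fun m ha => ?_⟩
  refine (sum_stepWeight_le hη hθ hγ hγ1 hc (by positivity) ha m).trans ?_
  set x : ℝ := ((m + 1 : ℕ) : ℝ) with hx
  have hx0 : 0 < x := by positivity
  have hx1 : 1 ≤ x := by rw [hx]; exact_mod_cast Nat.succ_le_succ (Nat.zero_le m)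
  have hl : 1 / 2 ≤ Real.log (2 * x) := by
    have h1 := Real.log_two_gt_d9
    have h2 := Real.log_le_log two_pos (by linarith : 2 ≤ 2 * x)
    linarith
  have hlx : Real.log (2 * x) ≤ 2 * x := (Real.log_le_sub_one_of_pos (by positivity)).trans
    (by linarith)
  have e1 : x ^ (θ - 1 + ε) * (η₁ * x ^ (1 - θ)) = η₁ * x ^ ε := by
    rw [mul_left_comm, ← Real.rpow_add hx0]
    congr 2
    ring
  have h1 : x ^ (γ - θ * (γ + 1) + max (2 * θ - 1) 0) ≤ x ^ (2 : ℝ) := by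
    refine Real.rpow_le_rpow_of_exponent_le hx1 ?_
    have : max (2 * θ - 1) 0 ≤ 1 := max_le (by linarith) zero_le_one
    nlinarith [mul_nonneg hθ hγ]
  have h2 : Real.log (2 * x) * (x ^ (γ - θ * (γ + 1) + max (2 * θ - 1) 0) *
      Real.exp (-(η₁ * x ^ ε))) ≤ 2 * C₀ * x ^ (-2 : ℝ) := by
    have h3 : x ^ (5 : ℝ) * x ^ (-2 : ℝ) = x * x ^ (2 : ℝ) := by
      rw [← Real.rpow_add hx0, ← Real.rpow_one_add' hx0.le (by norm_num)]
      norm_num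
    calc _ ≤ 2 * x * (x ^ (2 : ℝ) * Real.exp (-(η₁ * x ^ ε))) := by gcongr
      _ = 2 * (x ^ (5 : ℝ) * Real.exp (-(η₁ * x ^ ε))) * x ^ (-2 : ℝ) := by
          linear_combination (-2 * Real.exp (-(η₁ * x ^ ε))) * h3
      _ ≤ _ := by gcongr; exact h0 x hx1
  have h4 : x ^ (-(2 * θ)) ≤ 2 * (x ^ (γ - θ * (γ + 1)) * Real.log (2 * x)) := by
    have h5 : x ^ (-(2 * θ)) ≤ x ^ (γ - θ * (γ + 1)) :=
      Real.rpow_le_rpow_of_exponent_le hx1 (by nlinarith)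
    have : 0 < x ^ (γ - θ * (γ + 1)) := by positivity
    nlinarith
  rw [e1]
  set q := x ^ (γ - θ * (γ + 1)) * Real.log (2 * x) with hq
  have hq0 : 0 ≤ q := by positivity
  have hz0 : 0 < x ^ (-2 : ℝ) := by positivity
  set K := κ ^ 2 * c * η₁ ^ (1 + γ) with hK
  have hK0 : 0 ≤ K := by positivity
  calc _ = K * (Real.log (2 * x) * (x ^ (γ - θ * (γ + 1) + max (2 * θ - 1) 0) *
        Real.exp (-(η₁ * x ^ ε)))) + K * 2 ^ (2 * θ) * q + κ ^ 4 * η₁ ^ 2 * x ^ (-(2 * θ)) := by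
        rw [hq]; ring
    _ ≤ K * (2 * C₀ * x ^ (-2 : ℝ)) + K * 2 ^ (2 * θ) * q + κ ^ 4 * η₁ ^ 2 * (2 * q) := by gcongr
    _ ≤ _ := by
        have : 0 ≤ K * 2 ^ (2 * θ) * x ^ (-2 : ℝ) := by positivity
        have : 0 ≤ κ ^ 4 * η₁ ^ 2 * x ^ (-2 : ℝ) := by positivity
        have : 0 ≤ K * C₀ * q := by positivity
        nlinarith

end StepSizes

/-! ### Closing the recursion. -/

theorem stepWeight_nonneg {κ c γ lam : ℝ} {a : ℕ → ℝ} (hc : 0 ≤ c) (ha : ∀ i, 0 ≤ a i) (s n : ℕ) :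
    0 ≤ stepWeight κ c γ lam a s n := by
  have : 0 ≤ ∑ i ∈ Finset.Ico (s + 1) n, a i := Finset.sum_nonneg fun i _ => ha i
  unfold stepWeight
  split_ifs <;> positivity

theorem two_mul_ofReal (y : ℝ) : 2 * ENNReal.ofReal y = ENNReal.ofReal (2 * y) := by
  rw [ENNReal.ofReal_mul zero_le_two, ENNReal.ofReal_ofNat]

namespace Problem

open BoundedPositive

variable {α V : Type*} [MeasurableSpace α] [MeasurableSpace V] {P : Problem α V} {κ : ℝ}

variable [SecondCountableTopology (Lp ℝ 2 P.ρX)]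

theorem ofReal_mul_lintegral_le_stepWeight {γ c lam : ℝ} (hκ : 0 ≤ κ) (hb : P.BoundedBy κ)
    (hcap : P.CapacityBound γ c) (hlam : 0 ≤ lam) {a : ℕ → ℝ}
    (ha : ∀ i, 0 < a i ∧ a i * (κ ^ 2 + lam) < 1) {s n : ℕ} (hs : s < n) :
    ENNReal.ofReal (κ ^ 2 * a s ^ 2) *
      ∫⁻ v, ENNReal.ofReal (‖stepProd P.LK lam a (Finset.Ico (s + 1) n) (P.feature v)‖ ^ 2) ∂P.μ
      ≤ ENNReal.ofReal (stepWeight κ c γ lam a s n) := by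
  rw [stepWeight, ENNReal.ofReal_mul (p := κ ^ 2 * a s ^ 2) (by positivity)]
  refine mul_le_mul' le_rfl ?_
  -- For `s + 1 = n` no step remains and the sum of step sizes is `0`, where the capacity estimate
  -- gives nothing; `‖φ_v‖ ≤ κ` is used instead.
  split_ifs with h
  · rw [h, Finset.Ico_self, stepProd_empty]
    have h1 : ∫⁻ v, ENNReal.ofReal (‖(1 : Lp ℝ 2 P.ρX →L[ℝ] Lp ℝ 2 P.ρX) (P.feature v)‖ ^ 2) ∂P.μ
        ≤ ∫⁻ _, ENNReal.ofReal (κ ^ 2) ∂P.μ := by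
      refine lintegral_mono_ae ?_
      filter_upwards [hb.ae_norm_feature_le hκ] with v hv
      exact ENNReal.ofReal_le_ofReal (pow_le_pow_left₀ (norm_nonneg _) hv 2)
    simpa using h1
  · exact lintegral_norm_sq_stepProd_le hκ hb hcap hlam (fun i _ => ⟨(ha i).1.le, (ha i).2⟩)
      (Finset.sum_pos (fun i _ => (ha i).1) (Finset.nonempty_Ico.2 (by omega)))

theorem errorAlong_one_le {γ c lam : ℝ} (hκ : 0 ≤ κ) (hb : P.BoundedBy κ)
    (hcap : P.CapacityBound γ c) (hlam : 0 ≤ lam) {η : ℕ → ℝ}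
    (hη : ∀ i, 0 < η (i + 1) ∧ η (i + 1) * (κ ^ 2 + lam) < 1)
    {fρ h : Lp ℝ 2 P.ρX} (hρ : fρ =ᵐ[P.ρX] P.regression) (hh : P.LK h + lam • h = P.LK fρ)
    (n : ℕ) :
    P.errorAlong lam η h n 1 ≤
      ENNReal.ofReal ((Real.exp (-(lam * ∑ i ∈ Finset.range n, η (i + 1))) * ‖h‖) ^ 2) +
      ∑ s ∈ Finset.range n, ENNReal.ofReal (stepWeight κ c γ lam (fun i => η (i + 1)) s n) *
        P.expectedRisk lam η s := by
  have h1 := errorAlong_le_sum hκ hb η hρ hh n le_rfl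
  rw [Finset.Ico_self, stepProd_empty] at h1
  refine h1.trans (add_le_add (ENNReal.ofReal_le_ofReal ?_) ?_)
  · refine pow_le_pow_left₀ (norm_nonneg _) ?_ 2
    refine ((boundedPositive_LK hκ hb).norm_stepProd_le (sq_nonneg κ)
      (fun i _ => ⟨(hη i).1.le, (hη i).2⟩) h).trans ?_
    refine mul_le_mul_of_nonneg_right (prod_one_sub_le_exp fun i _ => ?_) (norm_nonneg _)
    nlinarith [(hη i).1, (hη i).2, mul_nonneg (hη i).1.le (sq_nonneg κ)]
  · refine Finset.sum_le_sum fun s hs => mul_le_mul_left ?_ _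
    exact ofReal_mul_lintegral_le_stepWeight hκ hb hcap hlam hη (Finset.mem_range.1 hs)

/-- If the weights sum to at most `1/2`, the errors are bounded and the last one is controlled by
the sum of the weights. -/
theorem errorAlong_one_le_of_sum_le {γ c lam : ℝ} (hκ : 0 ≤ κ) (hb : P.BoundedBy κ)
    (hcap : P.CapacityBound γ c) (hc : 0 ≤ c) (hlam : 0 ≤ lam) {η : ℕ → ℝ}
    (hη : ∀ i, 0 < η (i + 1) ∧ η (i + 1) * (κ ^ 2 + lam) < 1)
    {fρ h : Lp ℝ 2 P.ρX} (hρ : fρ =ᵐ[P.ρX] P.regression) (hh : P.LK h + lam • h = P.LK fρ)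
    {A Q : ℝ} (hA : ‖h‖ ≤ A) (hQ0 : 0 ≤ Q)
    (hQ : ENNReal.ofReal (6 * ‖h - fρ‖ ^ 2) + 6 * P.risk P.regression ≤ ENNReal.ofReal Q)
    {N : ℕ} (hw : ∀ n ≤ N, ∑ s ∈ Finset.range n,
      stepWeight κ c γ lam (fun i => η (i + 1)) s n ≤ 1 / 2) {n : ℕ} (hn : n ≤ N) :
    P.errorAlong lam η h n 1 ≤ ENNReal.ofReal
        (Real.exp (-(2 * (lam * ∑ i ∈ Finset.range n, η (i + 1)))) * A ^ 2 +
        (∑ s ∈ Finset.range n, stepWeight κ c γ lam (fun i => η (i + 1)) s n) *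
          (6 * A ^ 2 + 4 * Q)) ∧
      P.errorAlong lam η h n 1 ≤ ENNReal.ofReal (4 * A ^ 2 + 2 * Q) := by
  induction n using Nat.strong_induction_on with
  | _ n ih =>
  have hw0 : ∀ s, 0 ≤ stepWeight κ c γ lam (fun i => η (i + 1)) s n :=
    fun s => stepWeight_nonneg hc (fun i => (hη i).1.le) s n
  -- The bound `4 A² + 2 Q` reproduces itself: it gives risk `3/2 (4 A² + 2 Q) + Q = 6 A² + 4 Q`,
  -- and `A²` plus half of this is `4 A² + 2 Q` again.
  have hrisk : ∀ s < n, P.expectedRisk lam η s ≤ ENNReal.ofReal (6 * A ^ 2 + 4 * Q) := by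
    intro s hs
    refine (expectedRisk_le lam η hρ h s).trans ?_
    refine (add_le_add (mul_le_mul_right (ih s hs (by omega)).2 _) hQ).trans ?_
    rw [← ENNReal.ofReal_mul (by norm_num), ← ENNReal.ofReal_add (by positivity) hQ0]
    exact ENNReal.ofReal_le_ofReal (by linarith)
  have h1 : P.errorAlong lam η h n 1 ≤ ENNReal.ofReal
        (Real.exp (-(2 * (lam * ∑ i ∈ Finset.range n, η (i + 1)))) * A ^ 2 +
        (∑ s ∈ Finset.range n, stepWeight κ c γ lam (fun i => η (i + 1)) s n) *
          (6 * A ^ 2 + 4 * Q)) := by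
    refine (errorAlong_one_le hκ hb hcap hlam hη hρ hh n).trans ?_
    rw [Finset.sum_mul, ENNReal.ofReal_add (by positivity)
      (Finset.sum_nonneg fun s _ => mul_nonneg (hw0 s) (by positivity)),
      ENNReal.ofReal_sum_of_nonneg fun s _ => mul_nonneg (hw0 s) (by positivity)]
    refine add_le_add (ENNReal.ofReal_le_ofReal ?_) (Finset.sum_le_sum fun s hs => ?_)
    · rw [mul_pow, ← Real.exp_nat_mul]
      refine mul_le_mul (le_of_eq ?_) (pow_le_pow_left₀ (norm_nonneg _) hA 2) (by positivity)
        (by positivity)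
      congr 1
      push_cast
      ring
    · rw [ENNReal.ofReal_mul (hw0 s)]
      exact mul_le_mul_right (hrisk s (Finset.mem_range.1 hs)) _
  refine ⟨h1, h1.trans (ENNReal.ofReal_le_ofReal ?_)⟩
  have h2 : Real.exp (-(2 * (lam * ∑ i ∈ Finset.range n, η (i + 1)))) ≤ 1 := by
    rw [Real.exp_le_one_iff, neg_nonpos]
    exact mul_nonneg zero_le_two (mul_nonneg hlam (Finset.sum_nonneg fun i _ => (hη i).1.le))
  have h3 := mul_le_mul_of_nonneg_right h2 (sq_nonneg A)
  have h4 := mul_le_mul_of_nonneg_right (hw n hn) (by positivity : 0 ≤ 6 * A ^ 2 + 4 * Q)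
  linarith

theorem expectedError_le (lam : ℝ) (η : ℕ → ℝ) {fρ : Lp ℝ 2 P.ρX}
    (hρ : fρ =ᵐ[P.ρX] P.regression) (h : Lp ℝ 2 P.ρX) (T : ℕ) :
    P.expectedError lam η T ≤
      2 * P.errorAlong lam η h T 1 + ENNReal.ofReal (2 * ‖h - fρ‖ ^ 2) := by
  have h1 : P.expectedError lam η T ≤ ∫⁻ w, (2 *
      ENNReal.ofReal (‖(1 : Lp ℝ 2 P.ρX →L[ℝ] Lp ℝ 2 P.ρX)
        (toL2 P.ρX (P.iterate lam η T w) - h)‖ ^ 2) +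
      ENNReal.ofReal (2 * ‖h - fρ‖ ^ 2)) ∂(P.sampleLaw T) := by
    refine lintegral_mono_ae ?_
    filter_upwards [P.ae_memLp_iterate lam η T] with w hw
    have h2 : P.rhoNorm (fun u => P.iterate lam η T w u - P.regression u)
        = ‖toL2 P.ρX (P.iterate lam η T w) - fρ‖ₑ := by
      rw [enorm_toL2_sub hw]
      refine eLpNorm_congr_ae ?_
      filter_upwards [hρ] with x hx
      rw [hx]
    rw [h2, ← ofReal_norm, ← ENNReal.ofReal_pow (norm_nonneg _), two_mul_ofReal,
      ← ENNReal.ofReal_add (by positivity) (by positivity)]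
    refine ENNReal.ofReal_le_ofReal ?_
    rw [one_apply_eq_self]
    have h3 := norm_add_le (toL2 P.ρX (P.iterate lam η T w) - h) (h - fρ)
    rw [sub_add_sub_cancel] at h3
    have h4 := pow_le_pow_left₀ (norm_nonneg _) h3 2
    nlinarith [sq_nonneg (‖toL2 P.ρX (P.iterate lam η T w) - h‖ - ‖h - fρ‖)]
  refine h1.trans_eq ?_
  rw [lintegral_add_right _ measurable_const,
    lintegral_const_mul _ (P.measurable_error lam η h T 1), lintegral_const]
  simp [errorAlong]

end Problem

/-! ### The final rates. -/

theorem rate_comparison {q p : ℝ} (hq : -2 ≤ q) {m : ℕ} :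
    ((m + 1 : ℕ) : ℝ) ^ (-2 : ℝ) + ((m + 1 : ℕ) : ℝ) ^ p * Real.log (2 * (m + 1 : ℕ))
      ≤ 2 * (((m + 1 : ℕ) : ℝ) ^ q + ((m + 1 : ℕ) : ℝ) ^ p * Real.log (m + 1 : ℕ)) := by
  -- At `T = 1` the logarithm on the right vanishes and the term `x^q = 1` has to carry `log 2`.
  rcases Nat.eq_zero_or_pos m with rfl | hm
  · have : Real.log 2 ≤ 1 := by linarith [Real.log_two_lt_d9]
    norm_num
    linarith
  · have h2 : (2 : ℝ) ≤ (m + 1 : ℕ) := by exact_mod_cast Nat.succ_le_succ hm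
    set x : ℝ := ((m + 1 : ℕ) : ℝ)
    have h3 : x ^ (-2 : ℝ) ≤ x ^ q := Real.rpow_le_rpow_of_exponent_le (by linarith) hq
    have h4 : Real.log (2 * x) ≤ 2 * Real.log x := by
      rw [Real.log_mul two_ne_zero (by positivity)]
      linarith [Real.log_le_log two_pos h2]
    have h5 : 0 < x ^ q := by positivity
    have h6 := mul_le_mul_of_nonneg_left h4 (by positivity : 0 ≤ x ^ p)
    linarith

theorem exp_sum_polyStep_le {η₁ θ ε C : ℝ} (hη : 0 < η₁) (hθ : 0 ≤ θ) (hθ1 : θ < 1)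
    (hC : ∀ x : ℝ, 1 ≤ x → x ^ (5 : ℝ) * Real.exp (-(η₁ * x ^ ε)) ≤ C) (m : ℕ) :
    Real.exp (-(2 * (((m + 1 : ℕ) : ℝ) ^ (θ - 1 + ε) * ∑ i ∈ Finset.range (m + 1),
      polyStep η₁ θ i))) ≤ C * ((m + 1 : ℕ) : ℝ) ^ (-2 : ℝ) := by
  have h1 := le_sum_polyStep hη hθ 0 (m + 1)
  rw [Nat.sub_zero, ← Finset.range_eq_Ico] at h1
  have hx1 : (1 : ℝ) ≤ ((m + 1 : ℕ) : ℝ) := by exact_mod_cast Nat.succ_le_succ (Nat.zero_le m)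
  set x : ℝ := ((m + 1 : ℕ) : ℝ) with hx
  have hx0 : 0 < x := by linarith
  have h2 : x ^ (θ - 1 + ε) * (x * (η₁ * x ^ (-θ))) = η₁ * x ^ ε := by
    rw [show x * (η₁ * x ^ (-θ)) = η₁ * (x * x ^ (-θ)) by ring, mul_left_comm,
      ← Real.rpow_one_add' hx0.le (by linarith), ← Real.rpow_add hx0]
    congr 2
    ring
  have h3 := mul_le_mul_of_nonneg_left h1 (by positivity : 0 ≤ x ^ (θ - 1 + ε))
  rw [h2] at h3
  have h4 : 0 ≤ η₁ * x ^ ε := by positivity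
  have h5 : x ^ (2 : ℝ) ≤ x ^ (5 : ℝ) := Real.rpow_le_rpow_of_exponent_le hx1 (by norm_num)
  calc _ ≤ Real.exp (-(η₁ * x ^ ε)) := by
        rw [Real.exp_le_exp]
        linarith
    _ = x ^ (2 : ℝ) * Real.exp (-(η₁ * x ^ ε)) * x ^ (-2 : ℝ) := by
        rw [mul_right_comm, ← Real.rpow_add hx0]
        norm_num
    _ ≤ x ^ (5 : ℝ) * Real.exp (-(η₁ * x ^ ε)) * x ^ (-2 : ℝ) := by gcongr
    _ ≤ _ := by gcongr; exact hC x hx1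

theorem combine_rates {e S z w q C₀ C₁ A D R b : ℝ} (he : e ≤ C₀ * z) (hS : S ≤ C₁ * (z + w))
    (hzw : z + w ≤ 2 * q) (hw : 0 ≤ w) (hC₀ : 0 ≤ C₀) (hC₁ : 0 ≤ C₁) (hD : 0 ≤ D)
    (hb : b ≤ R ^ 2 * q) :
    2 * (e * A ^ 2 + S * D) + 2 * b ≤ (4 * (C₀ * A ^ 2 + C₁ * D) + 2 * R ^ 2) * q := by
  have h1 : e ≤ C₀ * (2 * q) := he.trans (mul_le_mul_of_nonneg_left (by linarith) hC₀)
  have h2 : S ≤ C₁ * (2 * q) := hS.trans (mul_le_mul_of_nonneg_left hzw hC₁)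
  have h3 := mul_le_mul_of_nonneg_right h1 (sq_nonneg A)
  have h4 := mul_le_mul_of_nonneg_right h2 hD
  linarith

end DoublyStochastic

end

theorem mainTheorem7
    (ζ R γ c κ θ ε η₁ : ℝ)
    (hζ : 0 < ζ) (hζ1 : ζ ≤ 1) (hR : 0 < R)
    (hγ : γ ∈ Set.Icc (0 : ℝ) 1) (hγ1 : γ ≠ 1) (hc : 0 < c) (hκ : 1 ≤ κ)
    (hθ : γ / (γ + 1) < θ) (hθ1 : θ < 1) (hε : 0 < ε) (hε1 : ε ≤ 1 - θ) (hη : 0 < η₁)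
    (A B : ℝ≥0) :
    ∃ C : ℝ, 0 < C ∧
      ∀ (d : ℕ) (X : Set (EuclideanSpace ℝ (Fin d))), IsClosed X →
      ∀ (V : Type*) [MeasurableSpace V] (P : DoublyStochastic.Problem X V),
        P.BoundedBy κ → P.RegularityBound ζ R → P.CapacityBound γ c →
        P.rhoNorm P.regression ≤ A → P.risk P.regression ≤ B →
        ∀ (T : ℕ) (hT : 1 ≤ T),
          η₁ ≤ 1 / (4 * κ ^ 2 * ((2 : ℝ) ^ (2 * θ) * c + κ ^ 2) *
            DoublyStochastic.cThetaGamma θ γ T hT) →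
          P.expectedError ((T : ℝ) ^ (θ - 1 + ε)) (fun t => η₁ * (t : ℝ) ^ (-θ)) T ≤
            ENNReal.ofReal (C * ((T : ℝ) ^ (2 * ζ * (θ - 1 + ε)) +
              (T : ℝ) ^ (γ - θ * (γ + 1)) * Real.log T)) := by
  obtain ⟨hγ0, hγ1'⟩ := hγ
  have hθ0 : 0 ≤ θ := (div_nonneg hγ0 (by linarith)).trans hθ.le
  have hκ0 : 0 ≤ κ := by linarith
  obtain ⟨C₀, hC₀, hexp⟩ := DoublyStochastic.exists_pow_mul_exp_le hη hε
  obtain ⟨C₁, hC₁, hsum⟩ := DoublyStochastic.exists_sum_stepWeight_le hη hθ0 hθ1.le hγ0 hγ1' hc hε κ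
  set Q : ℝ := 6 * (A : ℝ) ^ 2 + 6 * B with hQdef
  have hQ0 : 0 ≤ Q := by positivity
  refine ⟨4 * (C₀ * (A : ℝ) ^ 2 + C₁ * (6 * (A : ℝ) ^ 2 + 4 * Q)) + 2 * R ^ 2, by positivity, ?_⟩
  intro d X _ V _ P hb hreg hcap hnorm hrisk T hT hηT
  obtain ⟨m, rfl⟩ : ∃ m, T = m + 1 := ⟨T - 1, by omega⟩
  obtain ⟨g, hgR, hρ⟩ := hreg
  set fρ := DoublyStochastic.spectralPower P.LK ζ g with hfρ
  have : Fact ((2 : ℝ≥0∞) ≠ ∞) := ⟨ENNReal.ofNat_ne_top⟩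
  have : IsProbabilityMeasure P.ρX := inferInstance
  -- Separability of `L²(ρ_X)` comes from `X` lying in a Euclidean space.
  have : SecondCountableTopology (Lp ℝ 2 P.ρX) := inferInstance
  have hL := DoublyStochastic.Problem.boundedPositive_LK hκ0 hb
  have hx1 : (1 : ℝ) ≤ ((m + 1 : ℕ) : ℝ) := by exact_mod_cast hT
  set x : ℝ := ((m + 1 : ℕ) : ℝ) with hx
  have hx0 : 0 < x := by linarith
  set lam : ℝ := x ^ (θ - 1 + ε) with hlamdef
  have hlam : 0 < lam := by positivity
  have hlam1 : lam ≤ 1 := Real.rpow_le_one_of_one_le_of_nonpos hx1 (by linarith)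
  -- the regularized solution
  obtain ⟨u, hu⟩ : ∃ u, P.LK u + lam • u = fρ := ⟨_, hL.resolvent_apply hlam fρ⟩
  have hA : ‖fρ‖ ≤ A := by
    have h1 : ‖fρ‖ₑ ≤ A := by
      rw [Lp.enorm_def]
      refine le_trans (le_of_eq ?_) hnorm
      exact eLpNorm_congr_ae hρ
    have := ENNReal.toReal_mono ENNReal.coe_ne_top h1
    simpa using this
  obtain ⟨hu1, hu2⟩ := hL.norm_le_of_add_smul_eq hlam.le hu
  -- The comparison point is `h = L u`: then `h - f_ρ = -λ u`, and both `‖h‖` and `‖h - f_ρ‖` are at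
  -- most `‖f_ρ‖`.
  have hh : P.LK (P.LK u) + lam • P.LK u = P.LK fρ := by rw [← hu, map_add, map_smul]
  have hd : ‖P.LK u - fρ‖ = lam * ‖u‖ := by
    rw [← hu, sub_add_cancel_left, norm_neg, norm_smul, Real.norm_of_nonneg hlam.le]
  have hdR : ‖P.LK u - fρ‖ ≤ lam ^ ζ * R := by
    rw [hd]
    exact (hL.norm_resolvent_spectralPower_le hlam hζ hζ1 hu).trans (by gcongr)
  have hQ : ENNReal.ofReal (6 * ‖P.LK u - fρ‖ ^ 2) + 6 * P.risk P.regression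
      ≤ ENNReal.ofReal Q := by
    rw [hQdef, ENNReal.ofReal_add (by positivity) (by positivity)]
    refine add_le_add (ENNReal.ofReal_le_ofReal ?_) ?_
    · rw [hd]
      have := pow_le_pow_left₀ (by positivity) (hu2.trans hA) 2
      linarith
    · rw [ENNReal.ofReal_mul (by norm_num), ENNReal.ofReal_coe_nnreal]
      simpa using mul_le_mul_right hrisk 6
  -- the step sizes
  have hM : ∀ n : ℕ, 1 ≤ n → n ≤ m + 1 →
      (n : ℝ) ^ (γ - θ * (γ + 1) + max (2 * θ - 1) 0) * Real.log (2 * n)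
        ≤ DoublyStochastic.cThetaGamma θ γ (m + 1) hT := fun n h1 h2 =>
    Finset.le_sup' (fun t : ℕ => (t : ℝ) ^ (γ - θ * (γ + 1) + max (2 * θ - 1) 0) *
      Real.log (2 * t)) (Finset.mem_Icc.2 ⟨h1, h2⟩)
  -- The term `t = 1` of the maximum.
  have hM2 : Real.log 2 ≤ DoublyStochastic.cThetaGamma θ γ (m + 1) hT := by
    simpa using hM 1 le_rfl (by omega)
  obtain ⟨-, hηκ, hη1⟩ := DoublyStochastic.step_le_one hη hκ hc hM2 hηT
  have hstep : ∀ i, 0 < DoublyStochastic.polyStep η₁ θ i ∧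
      DoublyStochastic.polyStep η₁ θ i * (κ ^ 2 + lam) < 1 := by
    intro i
    refine ⟨DoublyStochastic.polyStep_pos hη i, lt_of_le_of_lt ?_ hηκ⟩
    exact mul_le_mul (DoublyStochastic.polyStep_le hη hθ0 i) (by linarith) (by positivity) hη.le
  have hsl : ∀ i, DoublyStochastic.polyStep η₁ θ i * lam ≤ 1 := by
    intro i
    nlinarith [(hstep i).1, (hstep i).2, mul_nonneg (hstep i).1.le (sq_nonneg κ)]
  have hw : ∀ n ≤ m + 1, ∑ s ∈ Finset.range n,
      DoublyStochastic.stepWeight κ c γ lam (DoublyStochastic.polyStep η₁ θ) s n ≤ 1 / 2 := by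
    intro n hn
    rcases n with _ | n
    · norm_num
    · exact DoublyStochastic.sum_stepWeight_le_half hη hθ0 hγ0 hγ1' hc hκ hlam.le hsl hM2 hηT n
        (hM (n + 1) (by omega) hn)
  have herr := (DoublyStochastic.Problem.errorAlong_one_le_of_sum_le
    (η := fun t => η₁ * (t : ℝ) ^ (-θ)) hκ0 hb hcap hc.le hlam.le hstep hρ hh (hu1.trans hA) hQ0 hQ
    hw le_rfl).1
  -- the rates
  have hinit := DoublyStochastic.exp_sum_polyStep_le hη hθ0 hθ1 hexp m
  rw [← hx, ← hlamdef] at hinit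
  have hsumT := hsum m hsl
  -- The leftover `T⁻²` is dominated by the bias rate, since `ζ ≤ 1` and `θ - 1 + ε ≥ -1` give an
  -- exponent at least `-2`.
  have hrate := DoublyStochastic.rate_comparison (q := 2 * ζ * (θ - 1 + ε))
    (p := γ - θ * (γ + 1)) (m := m) (by nlinarith)
  rw [← hx] at hsumT hrate
  have hlamζ : (lam ^ ζ) ^ 2 = x ^ (2 * ζ * (θ - 1 + ε)) := by
    rw [hlamdef, ← Real.rpow_mul hx0.le, ← Real.rpow_mul_natCast hx0.le]
    congr 1
    push_cast
    ring
  refine (DoublyStochastic.Problem.expectedError_le _ _ hρ (P.LK u) (m + 1)).trans ?_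
  refine (add_le_add (mul_le_mul_right herr 2) le_rfl).trans ?_
  have hS0 : 0 ≤ ∑ s ∈ Finset.range (m + 1),
      DoublyStochastic.stepWeight κ c γ lam (DoublyStochastic.polyStep η₁ θ) s (m + 1) :=
    Finset.sum_nonneg fun s _ => DoublyStochastic.stepWeight_nonneg hc.le
      (fun i => (hstep i).1.le) s _
  rw [DoublyStochastic.two_mul_ofReal]
  change ENNReal.ofReal (2 * (Real.exp (-(2 * (lam * ∑ i ∈ Finset.range (m + 1),
    DoublyStochastic.polyStep η₁ θ i))) * (A : ℝ) ^ 2 + (∑ s ∈ Finset.range (m + 1),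
      DoublyStochastic.stepWeight κ c γ lam (DoublyStochastic.polyStep η₁ θ) s (m + 1)) *
        (6 * (A : ℝ) ^ 2 + 4 * Q))) + _ ≤ _
  rw [← ENNReal.ofReal_add (mul_nonneg zero_le_two (add_nonneg (by positivity)
      (mul_nonneg hS0 (by positivity)))) (by positivity)]
  refine ENNReal.ofReal_le_ofReal ?_
  have hlogx : 0 ≤ Real.log x := Real.log_nonneg hx1
  have hlog2 : 0 ≤ Real.log (2 * x) := Real.log_nonneg (by linarith)
  have h1 : ‖P.LK u - fρ‖ ^ 2 ≤ R ^ 2 *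
      (x ^ (2 * ζ * (θ - 1 + ε)) + x ^ (γ - θ * (γ + 1)) * Real.log x) := by
    refine (pow_le_pow_left₀ (norm_nonneg _) hdR 2).trans ?_
    rw [mul_pow, hlamζ, mul_comm]
    exact mul_le_mul_of_nonneg_left (le_add_of_nonneg_right (by positivity)) (sq_nonneg R)
  exact DoublyStochastic.combine_rates hinit hsumT hrate (by positivity) hC₀.le hC₁.le
    (by positivity) h1
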